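/- Let $\mathcal G$ be a connected compact metric graph (finitely many edges $e$, each identified with an interval $[0,\ell_e]$, $0<\ell_e<\infty$; loops and multiple edges are allowed), let $p>2$, let $m^*\ge 1$ be an integer, and let $W,\rho\in L^\infty(\mathcal G)$ be real functions such that $\rho$ is not a.e. zero and, for some $a>0$, on every edge $e$ either $\rho\ge a$ a.e. or $\rho=0$ a.e. Let $H^1(\mathcal G)$ be the space of continuous functions on $\mathcal G$ whose restriction to each edge $e$ lies in $H^1(0,\ell_e)$. For $\lambda\in\mathbb R$, a function $u\in H^1(\mathcal G)$ is called a solution of $$-u''+W(x)u+\lambda u=\rho(x)|u|^{p-2}u \quad\text{on } \mathcal G,\ \text{with Kirchhoff conditions at the vertices}, \qquad (*)$$ if $$\int_{\mathcal G}\big(u'\varphi'+(W+\lambda)u\varphi\big)\,dx=\int_{\mathcal G}\rho|u|^{p-2}u\varphi\,dx\quad\text{for all }\varphi\in H^1(\mathcal G).$$ Its Morse index $m(u)\in\{0,1,2,\dots\}\cup\{+\infty\}$ is the maximal dimension of a subspace of $H^1(\mathcal G)$ on which the quadratic form $$Q_u(\varphi)=\int_{\mathcal G}\big(|\varphi'|^2+(W+\lambda)\varphi^2-(p-1)\rho|u|^{p-2}\varphi^2\big)\,dx$$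 is negative definite. Put $$\Lambda_{m^*}=\inf\{\lambda\in\mathbb R:\ \text{there is a solution } u\in H^1(\mathcal G)\setminus\{0\}\text{ of }(*)\text{ with } m(u)\le m^*\}\in[-\infty,+\infty],$$ with $\inf\emptyset=+\infty$. Let $\lambda_1\le\lambda_2\le\cdots$ be the eigenvalues, counted with multiplicity, of $v\mapsto -v''+W(x)v$ on $\mathcal G$ with Kirchhoff conditions; that is, $\mu$ is an eigenvalue with eigenfunction $v\in H^1(\mathcal G)\setminus\{0\}$ if $\int_{\mathcal G}(v'\varphi'+Wv\varphi)\,dx=\mu\int_{\mathcal G}v\varphi\,dx$ for all $\varphi\in H^1(\mathcal G)$. Then $$\Lambda_{m^*}\ge-\lambda_{m^*+1}.$$ If moreover $m^*=1$ and $\operatorname{ess\,inf}_{\mathcal G}\rho>0$, then $$\Lambda_1=-\lambda_1,$$ and the infimum defining $\Lambda_1$ is not attained. -/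

import Mathlib

open MeasureTheory

noncomputable section

/-- A compact connected metric graph with vertex set `V` and edge set `E` (used with `E` finite).
Loops and multiple edges are allowed.  The edge `e` is identified with the interval
`[0, length e]`; the vertex `src e` corresponds to `0` and `tgt e` to `length e`.
Connectedness: any two vertices are joined by a finite chain of edges, regardless of orientation
(so `V` is finite when `E` is). -/
structure CompactMetricGraph (V E : Type*) where
  src : E → V
  tgt : E → V
  length : E → ℝ
  length_pos : ∀ e, 0 < length e
  nonempty : Nonempty V
  connected : ∀ v w : V, Relation.EqvGen (fun a b => ∃ e, src e = a ∧ tgt e = b) v w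

namespace CompactMetricGraph

variable {V E : Type*} (G : CompactMetricGraph V E)

/-- The closed interval `[0, length e]`. -/
abbrev Edge (e : E) : Type := Set.Icc (0 : ℝ) (G.length e)

/-- `volume` on an edge is the restriction of Lebesgue measure to `[0, length e]`. -/
instance (e : E) : MeasureSpace (G.Edge e) := Measure.Subtype.measureSpace

/-- The endpoint `0` of the edge. -/
def left (e : E) : G.Edge e := ⟨0, le_refl _, (G.length_pos e).le⟩

/-- The endpoint `length e` of the edge. -/
def right (e : E) : G.Edge e := ⟨G.length e, (G.length_pos e).le, le_refl _⟩

instance (e : E) : IsFiniteMeasure (volume : Measure (G.Edge e)) := by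
  refine ⟨?_⟩
  rw [Measure.Subtype.volume_univ measurableSet_Icc.nullMeasurableSet]
  exact measure_Icc_lt_top

/-- `HasL2Deriv u g`: the function `u` on the edge `e` is absolutely continuous with derivative
`g ∈ L²`, that is, `u x = u 0 + ∫₀ˣ g` for all `x`. -/
def HasL2Deriv {e : E} (u : C(G.Edge e, ℝ)) (g : Lp ℝ 2 (volume : Measure (G.Edge e))) : Prop :=
  ∀ x : G.Edge e, u x = u (G.left e) + ∫ y in Set.Iic x, g y

/-- A family of functions on the edges is continuous at the vertices: at each vertex, all the
incident edges give the same value. -/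
def ContinuousAtVertices (u : ∀ e, C(G.Edge e, ℝ)) : Prop :=
  ∃ c : V → ℝ, ∀ e, u e (G.left e) = c (G.src e) ∧ u e (G.right e) = c (G.tgt e)

variable {G} in
lemma HasL2Deriv.add {e : E} {u v : C(G.Edge e, ℝ)} {g h : Lp ℝ 2 (volume : Measure (G.Edge e))}
    (hu : G.HasL2Deriv u g) (hv : G.HasL2Deriv v h) : G.HasL2Deriv (u + v) (g + h) := by
  intro x
  have hg : Integrable g volume := (Lp.memLp g).integrable (by norm_num)
  have hh : Integrable h volume := (Lp.memLp h).integrable (by norm_num)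
  have : ∫ y in Set.Iic x, (g + h : Lp ℝ 2 (volume : Measure (G.Edge e))) y
      = (∫ y in Set.Iic x, g y) + ∫ y in Set.Iic x, h y := by
    rw [← integral_add hg.integrableOn hh.integrableOn]
    exact integral_congr_ae (ae_restrict_of_ae (Lp.coeFn_add g h))
  rw [this, ContinuousMap.add_apply, ContinuousMap.add_apply, hu x, hv x]
  ring

variable {G} in
lemma HasL2Deriv.smul {e : E} {u : C(G.Edge e, ℝ)} {g : Lp ℝ 2 (volume : Measure (G.Edge e))}
    (c : ℝ) (hu : G.HasL2Deriv u g) : G.HasL2Deriv (c • u) (c • g) := by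
  intro x
  have : ∫ y in Set.Iic x, (c • g : Lp ℝ 2 (volume : Measure (G.Edge e))) y
      = c * ∫ y in Set.Iic x, g y := by
    rw [← integral_const_mul]
    exact integral_congr_ae (ae_restrict_of_ae (Lp.coeFn_smul c g))
  rw [this, ContinuousMap.smul_apply, ContinuousMap.smul_apply, hu x, smul_eq_mul, smul_eq_mul]
  ring

lemma hasL2Deriv_zero (e : E) :
    G.HasL2Deriv (0 : C(G.Edge e, ℝ)) (0 : Lp ℝ 2 (volume : Measure (G.Edge e))) := by
  intro x
  have : ∫ y in Set.Iic x, (0 : Lp ℝ 2 (volume : Measure (G.Edge e))) y = 0 := by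
    rw [integral_congr_ae (ae_restrict_of_ae (Lp.coeFn_zero ℝ 2 (volume : Measure (G.Edge e))))]
    simp
  rw [this]
  simp

/-- The Sobolev space `H¹(G)`: functions on `G` that are continuous on the whole graph and whose
restriction to each edge is absolutely continuous with derivative in `L²`.  An element is stored
together with its derivative, as a pair `(u, u')`; the function `u` determines `u' ∈ L²`. -/
def H1 : Submodule ℝ
    ((∀ e, C(G.Edge e, ℝ)) × (∀ e, Lp ℝ 2 (volume : Measure (G.Edge e)))) where
  carrier := {f | (∀ e, G.HasL2Deriv (f.1 e) (f.2 e)) ∧ G.ContinuousAtVertices f.1}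
  add_mem' := by
    rintro f g ⟨hf, c, hc⟩ ⟨hg, d, hd⟩
    refine ⟨fun e => (hf e).add (hg e), c + d, fun e => ⟨?_, ?_⟩⟩
    · simp [(hc e).1, (hd e).1]
    · simp [(hc e).2, (hd e).2]
  zero_mem' := ⟨fun e => G.hasL2Deriv_zero e, 0, fun e => by simp⟩
  smul_mem' := by
    rintro a f ⟨hf, c, hc⟩
    refine ⟨fun e => (hf e).smul a, a • c, fun e => ⟨?_, ?_⟩⟩
    · simp [(hc e).1]
    · simp [(hc e).2]

variable {G}

/-- The values `u_e(x)` of `u ∈ H¹(G)`. -/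
def H1.val (u : G.H1) (e : E) (x : G.Edge e) : ℝ := u.1.1 e x

/-- The derivative `u_e'(x)` of `u ∈ H¹(G)`. -/
def H1.der (u : G.H1) (e : E) (x : G.Edge e) : ℝ := u.1.2 e x

/-- `u'` is determined by `u`: an element of `H¹(G)` whose values all vanish is zero. -/
lemma H1.eq_zero_of_val {u : G.H1} (h : ∀ e x, H1.val u e x = 0) : u = 0 := by
  have h1 : u.1.1 = 0 := by
    funext e
    ext x
    exact h e x
  have h2 : u.1.2 = 0 := by
    funext e
    have hg : Integrable (u.1.2 e) volume := (Lp.memLp (u.1.2 e)).integrable (by norm_num)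
    have hI : ∀ x, ∫ y in Set.Iic x, u.1.2 e y = 0 := by
      intro x
      have := u.2.1 e x
      rw [h1] at this
      simpa using this.symm
    have huniv : ∫ y, u.1.2 e y = 0 := by
      have := hI (G.right e)
      rwa [show Set.Iic (G.right e) = Set.univ from Set.eq_univ_of_forall fun y => y.2.2,
        setIntegral_univ] at this
    have hs : ∀ s : Set (G.Edge e), MeasurableSet s → ∫ y in s, u.1.2 e y = 0 := by
      intro s hs
      induction s, hs using MeasurableSpace.induction_on_inter
          (borel_eq_generateFrom_Iic (G.Edge e) ▸ BorelSpace.measurable_eq) isPiSystem_Iic with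
      | empty => simp
      | basic t ht =>
        obtain ⟨x, rfl⟩ := ht
        exact hI x
      | compl t ht ih => rw [setIntegral_compl ht hg, ih, huniv, sub_zero]
      | iUnion f hd hm ih => rw [integral_iUnion hm hd hg.integrableOn]; simp [ih]
    have := hg.ae_eq_zero_of_forall_setIntegral_eq_zero fun s hs' _ => hs s hs'
    exact (Lp.eq_zero_iff_ae_eq_zero).2 this
  exact Subtype.ext (Prod.ext h1 h2)

variable [Fintype E]

/-- The integral of a function over the graph. -/
def integral (f : ∀ e, G.Edge e → ℝ) : ℝ := ∑ e, ∫ x, f e x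

/-- `u ∈ H¹(G)` is a (weak) solution of `-u'' + W u + lam u = ρ |u|^(p-2) u` on `G` with Kirchhoff
conditions at the vertices: the equation is tested against all `φ ∈ H¹(G)` (on a compact graph all
of them have compact support). -/
def IsSolution (p : ℝ) (W ρ : ∀ e, G.Edge e → ℝ) (lam : ℝ) (u : G.H1) : Prop :=
  ∀ φ : G.H1,
    integral (fun e x => H1.der u e x * H1.der φ e x + (W e x + lam) * H1.val u e x * H1.val φ e x)
      = integral (fun e x => ρ e x * |H1.val u e x| ^ (p - 2) * H1.val u e x * H1.val φ e x)

/-- The quadratic form of the linearization at `u`. -/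
def quadForm (p : ℝ) (W ρ : ∀ e, G.Edge e → ℝ) (lam : ℝ) (u φ : G.H1) : ℝ :=
  integral (fun e x => H1.der φ e x ^ 2 + (W e x + lam) * H1.val φ e x ^ 2
    - (p - 1) * ρ e x * |H1.val u e x| ^ (p - 2) * H1.val φ e x ^ 2)

/-- The Morse index of `u`: the largest dimension (`⊤` if there is none) of a linear subspace of
`H¹(G)` on which the quadratic form at `u` is negative definite. -/
def morseIndex (p : ℝ) (W ρ : ∀ e, G.Edge e → ℝ) (lam : ℝ) (u : G.H1) : ℕ∞ :=
  sSup {m : ℕ∞ | ∃ (k : ℕ) (X : Submodule ℝ G.H1), m = k ∧ Module.rank ℝ X = k ∧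
    ∀ φ ∈ X, φ ≠ 0 → quadForm p W ρ lam u φ < 0}

/-- The real numbers `lam` for which there is a nonzero solution of Morse index at most `m`. -/
def admissible (p : ℝ) (W ρ : ∀ e, G.Edge e → ℝ) (m : ℕ) : Set ℝ :=
  {lam | ∃ u : G.H1, u ≠ 0 ∧ IsSolution p W ρ lam u ∧ morseIndex p W ρ lam u ≤ m}

/-- The infimum of the admissible `lam`, in the extended reals (`⊤` if there are none). -/
def bottom (p : ℝ) (W ρ : ∀ e, G.Edge e → ℝ) (m : ℕ) : EReal :=
  ⨅ lam ∈ admissible p W ρ m, (lam : EReal)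

/-- `v` solves `-v'' + W v = μ v` on `G` with Kirchhoff conditions, in the weak sense. -/
def IsLinearSolution (W : ∀ e, G.Edge e → ℝ) (μ : ℝ) (v : G.H1) : Prop :=
  ∀ φ : G.H1,
    integral (fun e x => H1.der v e x * H1.der φ e x + W e x * H1.val v e x * H1.val φ e x)
      = μ * integral (fun e x => H1.val v e x * H1.val φ e x)

/-- The linear span of the eigenfunctions of `v ↦ -v'' + W v` (with Kirchhoff conditions) whose
eigenvalue is at most `t`. -/
def spectralSpace (W : ∀ e, G.Edge e → ℝ) (t : ℝ) : Submodule ℝ G.H1 :=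
  Submodule.span ℝ {v | ∃ μ ≤ t, IsLinearSolution W μ v}

/-- The `k`-th eigenvalue (`k ≥ 1`), counted with multiplicity, of `v ↦ -v'' + W v` with Kirchhoff
conditions: the least `t` such that there are at least `k` linearly independent eigenfunctions
with eigenvalues at most `t`. -/
def eigenvalue (W : ∀ e, G.Edge e → ℝ) (k : ℕ) : ℝ :=
  sInf {t | (k : Cardinal) ≤ Module.rank ℝ (spectralSpace W t)}

end CompactMetricGraph

end

/-! ### Measure and bilinear forms on the graph -/

noncomputable section

open MeasureTheory Filter Topology

namespace CompactMetricGraph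

variable {V E : Type*} {G : CompactMetricGraph V E}

/-! Write A(φ) = ∫ φ'² + (W + λ)φ², so that the form at u is Q(φ) = A(φ) − (p−1)∫ ρ|u|^(p−2)φ². The
hypothesis on the edges gives ρ ≥ 0, hence Q ≤ A. If λ < −λ_{m+1}, then A is negative definite on an
(m+1)-dimensional space of combinations of eigenfunctions, so every u, solution or not, has index at
least m+1 (`le_morseIndex_of_lt_neg_eigenvalue`).

Let now m = 1 and ρ ≥ c > 0. For λ ≤ −λ_1 the form is tested on the span of the solution u and a
first eigenfunction φ. With P = ∫ ρ|u|^(p−2)(au+bφ)², the equation of u gives Q(au+bφ) = −(p−2)P −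
b²∫ ρ|u|^(p−2)φ² + b²(λ_1+λ)∫ φ², which is negative unless a = b = 0 (`neg_of_pencil`). The middle
integral is positive because φ has no zeros (`exists_pos_eigenfunction`). This follows from a bound
on the derivative of log(w+ε), uniform in ε, for a nonnegative eigenfunction w, together with
connectedness. So the index is at least 2.

For λ > −λ_1 the form A is coercive and A(w)/(∫ ρ|w|^p)^(2/p) attains its minimum. A rescaled
minimiser solves the equation, and the second order condition gives Q ≥ 0 on a hyperplane, so the
index is at most 1 (`exists_ground_state`). The admissible λ are thus exactly those above −λ_1.

Eigenfunctions and ground states both come from `exists_minimizer`: Arzelà–Ascoli gives uniform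
convergence, and the parallelogram law then makes the derivatives Cauchy in L², with no weak limits.
-/

lemma volume_edge_preimage {e : E} {t : Set ℝ} (ht : MeasurableSet t)
    (hsub : t ⊆ Set.Icc 0 (G.length e)) :
    volume ((↑) ⁻¹' t : Set (G.Edge e)) = volume t := by
  have h : volume.map ((↑) : G.Edge e → ℝ) = volume.restrict (Set.Icc 0 (G.length e)) :=
    MeasurableSet.map_coe_volume measurableSet_Icc
  rw [← Measure.map_apply measurable_subtype_coe ht, h, Measure.restrict_apply ht,
    Set.inter_eq_left.2 hsub]

/-- A relatively open set may meet the edge at an endpoint; density of the open interval supplies a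
nonempty open subset of the line inside it. This gives strict positivity of integrals of continuous
nonnegative functions. -/
instance (e : E) : Measure.IsOpenPosMeasure (volume : Measure (G.Edge e)) := by
  refine ⟨fun U hU ⟨x, hx⟩ => ?_⟩
  obtain ⟨O, hO, rfl⟩ := isOpen_induced_iff.1 hU
  have hcl : (x : ℝ) ∈ closure (Set.Ioo 0 (G.length e)) := by
    rw [closure_Ioo (G.length_pos e).ne]; exact x.2
  have hne : (O ∩ Set.Ioo 0 (G.length e)).Nonempty := mem_closure_iff.1 hcl O hO hx
  have hop : IsOpen (O ∩ Set.Ioo 0 (G.length e)) := hO.inter isOpen_Ioo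
  have h0 := hop.measure_ne_zero volume hne
  have h1 := volume_edge_preimage (G := G) (e := e) hop.measurableSet
    (Set.inter_subset_right.trans Set.Ioo_subset_Icc_self)
  intro h
  apply h0
  rw [← h1]
  exact measure_mono_null (fun y hy => hy.1) h

lemma integrable_weight_mul {e : E} {c : G.Edge e → ℝ} (hc : Integrable c) (f : C(G.Edge e, ℝ)) :
    Integrable fun x => c x * f x := by
  refine hc.mul_bdd (c := ‖f‖) f.continuous.aestronglyMeasurable ?_
  exact Eventually.of_forall fun x => f.norm_coe_le_norm x

/-- The functional is bounded by ‖c‖₁ times the sup norm. Hence the zero-order terms pass to the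
limit under uniform convergence alone. -/
lemma continuous_integral_weight {e : E} {c : G.Edge e → ℝ} (hc : Integrable c) :
    Continuous fun f : C(G.Edge e, ℝ) => ∫ x, c x * f x := by
  let T : C(G.Edge e, ℝ) →ₗ[ℝ] ℝ :=
    { toFun := fun f => ∫ x, c x * f x
      map_add' := fun f g => by
        rw [← MeasureTheory.integral_add (integrable_weight_mul hc f) (integrable_weight_mul hc g)]
        exact integral_congr_ae (Eventually.of_forall fun x => by simp [mul_add])
      map_smul' := fun a f => by
        rw [RingHom.id_apply, smul_eq_mul, ← integral_const_mul]
        exact integral_congr_ae (Eventually.of_forall fun x => by simp; ring) }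
  refine AddMonoidHomClass.continuous_of_bound T (∫ x, ‖c x‖) fun f => ?_
  calc ‖∫ x, c x * f x‖ ≤ ∫ x, ‖c x * f x‖ := norm_integral_le_integral_norm _
    _ ≤ ∫ x, ‖c x‖ * ‖f‖ := by
        refine integral_mono (integrable_weight_mul hc f).norm (hc.norm.mul_const _) fun x => ?_
        simp only [norm_mul]
        exact mul_le_mul_of_nonneg_left (f.norm_coe_le_norm x) (norm_nonneg _)
    _ = _ := integral_mul_const _ _

lemma continuous_val (u : G.H1) (e : E) : Continuous (H1.val u e) := (u.1.1 e).continuous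

lemma memLp_der (u : G.H1) (e : E) : MemLp (H1.der u e) 2 volume := Lp.memLp _

lemma integrable_der_mul (u v : G.H1) (e : E) :
    Integrable fun x => H1.der u e x * H1.der v e x :=
  (memLp_der u e).integrable_mul (memLp_der v e)

lemma val_add (u v : G.H1) (e : E) (x : G.Edge e) :
    H1.val (u + v) e x = H1.val u e x + H1.val v e x := rfl

lemma val_smul (a : ℝ) (u : G.H1) (e : E) (x : G.Edge e) :
    H1.val (a • u) e x = a * H1.val u e x := rfl

lemma integrable_mass {c : ∀ e, G.Edge e → ℝ} (hc : ∀ e, Integrable (c e)) (u v : G.H1) (e : E) :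
    Integrable fun x => c e x * H1.val u e x * H1.val v e x := by
  refine (integrable_weight_mul (hc e) (u.1.1 e * v.1.1 e)).congr (Eventually.of_forall fun x => ?_)
  simp [H1.val, mul_assoc]

lemma integrable_one (e : E) : Integrable (fun _ : G.Edge e => (1 : ℝ)) := integrable_const _

lemma integrable_weight_add_const {c : ∀ e, G.Edge e → ℝ} (hc : ∀ e, Integrable (c e)) (t : ℝ)
    (e : E) : Integrable fun x => c e x + t := (hc e).add (integrable_const t)

lemma exists_val_ne_zero {u : G.H1} (hu : u ≠ 0) : ∃ e x, H1.val u e x ≠ 0 := by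
  by_contra! h
  exact hu (H1.eq_zero_of_val h)

/-- The weight `ρ |u|^(p-2)` of the linearization at `u`. -/
def nlWeight (p : ℝ) (ρ : ∀ e, G.Edge e → ℝ) (u : G.H1) (e : E) (x : G.Edge e) : ℝ :=
  ρ e x * |H1.val u e x| ^ (p - 2)

lemma integrable_nlWeight {p : ℝ} (hp : 2 < p) {ρ : ∀ e, G.Edge e → ℝ}
    (hρ : ∀ e, Integrable (ρ e)) (u : G.H1) (e : E) : Integrable (nlWeight p ρ u e) :=
  integrable_weight_mul (hρ e) ⟨fun x => |H1.val u e x| ^ (p - 2),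
    (continuous_val u e).abs.rpow_const fun _ => Or.inr (by linarith)⟩

variable [Fintype E]

lemma integral_add {f g : ∀ e, G.Edge e → ℝ} (hf : ∀ e, Integrable (f e))
    (hg : ∀ e, Integrable (g e)) :
    integral (fun e x => f e x + g e x) = integral f + integral g := by
  simp only [integral, ← Finset.sum_add_distrib]
  exact Finset.sum_congr rfl fun e _ => MeasureTheory.integral_add (hf e) (hg e)

lemma integral_sub {f g : ∀ e, G.Edge e → ℝ} (hf : ∀ e, Integrable (f e))
    (hg : ∀ e, Integrable (g e)) :
    integral (fun e x => f e x - g e x) = integral f - integral g := by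
  simp only [integral, ← Finset.sum_sub_distrib]
  exact Finset.sum_congr rfl fun e _ => MeasureTheory.integral_sub (hf e) (hg e)

lemma integral_const_mul (a : ℝ) (f : ∀ e, G.Edge e → ℝ) :
    integral (fun e x => a * f e x) = a * integral f := by
  simp only [integral, Finset.mul_sum]
  exact Finset.sum_congr rfl fun e _ => MeasureTheory.integral_const_mul _ _

lemma integral_congr {f g : ∀ e, G.Edge e → ℝ} (h : ∀ e, f e =ᵐ[volume] g e) :
    integral f = integral g :=
  Finset.sum_congr rfl fun e _ => integral_congr_ae (h e)

lemma integral_mono {f g : ∀ e, G.Edge e → ℝ} (hf : ∀ e, Integrable (f e))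
    (hg : ∀ e, Integrable (g e)) (h : ∀ e, f e ≤ᵐ[volume] g e) : integral f ≤ integral g :=
  Finset.sum_le_sum fun e _ => integral_mono_ae (hf e) (hg e) (h e)

lemma integral_nonneg {f : ∀ e, G.Edge e → ℝ} (h : ∀ e, 0 ≤ᵐ[volume] f e) : 0 ≤ integral f :=
  Finset.sum_nonneg fun e _ => integral_nonneg_of_ae (h e)

/-- The bilinear form `∫ c u v` with an integrable weight `c`. -/
def mass (c : ∀ e, G.Edge e → ℝ) (hc : ∀ e, Integrable (c e)) : LinearMap.BilinForm ℝ G.H1 :=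
  LinearMap.mk₂ ℝ (fun u v => integral fun e x => c e x * H1.val u e x * H1.val v e x)
    (fun u u' v => by
      rw [← integral_add (integrable_mass hc u v) (integrable_mass hc u' v)]
      simp only [val_add, mul_add, add_mul])
    (fun a u v => by
      rw [smul_eq_mul, ← integral_const_mul]
      simp only [val_smul]
      congr! 3; ring)
    (fun u v v' => by
      rw [← integral_add (integrable_mass hc u v) (integrable_mass hc u v')]
      simp only [val_add, mul_add])
    (fun a u v => by
      rw [smul_eq_mul, ← integral_const_mul]
      simp only [val_smul]
      congr! 3; ring)

lemma mass_apply {c : ∀ e, G.Edge e → ℝ} (hc : ∀ e, Integrable (c e)) (u v : G.H1) :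
    mass c hc u v = integral fun e x => c e x * H1.val u e x * H1.val v e x := rfl

lemma mass_comm {c : ∀ e, G.Edge e → ℝ} (hc : ∀ e, Integrable (c e)) (u v : G.H1) :
    mass c hc u v = mass c hc v u := by
  simp only [mass_apply]
  congr! 3; ring

lemma mass_self_nonneg {c : ∀ e, G.Edge e → ℝ} (hc : ∀ e, Integrable (c e))
    (h0 : ∀ e, ∀ᵐ x, 0 ≤ c e x) (u : G.H1) : 0 ≤ mass c hc u u := by
  refine integral_nonneg fun e => ?_
  filter_upwards [h0 e] with x hx
  simp only [Pi.zero_apply, mul_assoc]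
  exact mul_nonneg hx (mul_self_nonneg _)

/-- The `L²` inner product on the graph. -/
def l2 : LinearMap.BilinForm ℝ G.H1 := mass (fun _ _ => 1) integrable_one

lemma l2_apply (u v : G.H1) :
    l2 u v = integral fun e x => H1.val u e x * H1.val v e x := by
  simp [l2, mass_apply]

lemma l2_comm (u v : G.H1) : l2 u v = l2 v u := mass_comm _ u v

lemma l2_self_nonneg (u : G.H1) : 0 ≤ l2 u u :=
  mass_self_nonneg _ (fun _ => Eventually.of_forall fun _ => zero_le_one) u

/-- The bilinear form `∫ u' v'`. -/
def dirichlet : LinearMap.BilinForm ℝ G.H1 :=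
  LinearMap.mk₂ ℝ (fun u v => ∑ e, inner ℝ (u.1.2 e) (v.1.2 e))
    (fun u u' v => by simp [inner_add_left, Finset.sum_add_distrib])
    (fun a u v => by simp [inner_smul_left, Finset.mul_sum])
    (fun u v v' => by simp [inner_add_right, Finset.sum_add_distrib])
    (fun a u v => by simp [inner_smul_right, Finset.mul_sum])

lemma dirichlet_apply (u v : G.H1) : dirichlet u v = ∑ e, inner ℝ (u.1.2 e) (v.1.2 e) := rfl

lemma dirichlet_eq_integral (u v : G.H1) :
    dirichlet u v = integral fun e x => H1.der u e x * H1.der v e x := by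
  refine Finset.sum_congr rfl fun e _ => ?_
  rw [L2.inner_def]
  refine integral_congr_ae (Eventually.of_forall fun x => ?_)
  simp [H1.der, mul_comm]

lemma dirichlet_comm (u v : G.H1) : dirichlet u v = dirichlet v u := by
  simp only [dirichlet_apply, real_inner_comm]

lemma dirichlet_self (u : G.H1) : dirichlet u u = ∑ e, ‖u.1.2 e‖ ^ 2 := by
  simp only [dirichlet_apply, real_inner_self_eq_norm_sq]

lemma dirichlet_self_nonneg (u : G.H1) : 0 ≤ dirichlet u u := by
  rw [dirichlet_self]; positivity

lemma norm_der_sq_le (u : G.H1) (e : E) : ‖u.1.2 e‖ ^ 2 ≤ dirichlet u u := by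
  rw [dirichlet_self]
  exact Finset.single_le_sum (f := fun e => ‖u.1.2 e‖ ^ 2) (fun _ _ => by positivity)
    (Finset.mem_univ e)

/-- The bilinear form `∫ u' v' + c u v`. -/
def energy (c : ∀ e, G.Edge e → ℝ) (hc : ∀ e, Integrable (c e)) : LinearMap.BilinForm ℝ G.H1 :=
  dirichlet + mass c hc

lemma energy_apply {c : ∀ e, G.Edge e → ℝ} (hc : ∀ e, Integrable (c e)) (u v : G.H1) :
    energy c hc u v = dirichlet u v + mass c hc u v := rfl

lemma energy_comm {c : ∀ e, G.Edge e → ℝ} (hc : ∀ e, Integrable (c e)) (u v : G.H1) :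
    energy c hc u v = energy c hc v u := by
  rw [energy_apply, energy_apply, dirichlet_comm, mass_comm]

lemma mass_add_const {c : ∀ e, G.Edge e → ℝ} (hc : ∀ e, Integrable (c e)) (t : ℝ) (u v : G.H1) :
    mass (fun e x => c e x + t) (integrable_weight_add_const hc t) u v
      = mass c hc u v + t * l2 u v := by
  rw [l2_apply, ← integral_const_mul, mass_apply, mass_apply,
    ← integral_add (integrable_mass hc u v)]
  · congr! 3; ring
  · intro e
    refine (integrable_mass (c := fun _ _ => t) (fun e => integrable_const t) u v e).congr
      (Eventually.of_forall fun x => ?_)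
    simp only; ring

lemma energy_add_const {c : ∀ e, G.Edge e → ℝ} (hc : ∀ e, Integrable (c e)) (t : ℝ) (u v : G.H1) :
    energy (fun e x => c e x + t) (integrable_weight_add_const hc t) u v
      = energy c hc u v + t * l2 u v := by
  rw [energy_apply, energy_apply, mass_add_const, add_assoc]

lemma energy_eq_integral {c : ∀ e, G.Edge e → ℝ} (hc : ∀ e, Integrable (c e)) (u v : G.H1) :
    energy c hc u v = integral fun e x =>
      H1.der u e x * H1.der v e x + c e x * H1.val u e x * H1.val v e x := by
  rw [integral_add (integrable_der_mul u v) (integrable_mass hc u v), energy_apply,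
    dirichlet_eq_integral, mass_apply]

lemma isLinearSolution_iff {W : ∀ e, G.Edge e → ℝ} (hW : ∀ e, Integrable (W e)) {μ : ℝ}
    {v : G.H1} : IsLinearSolution W μ v ↔ ∀ φ, energy W hW v φ = μ * l2 v φ := by
  simp only [IsLinearSolution, energy_eq_integral, l2_apply]

lemma isSolution_iff {p : ℝ} (hp : 2 < p) {W ρ : ∀ e, G.Edge e → ℝ}
    (hW : ∀ e, Integrable (W e)) (hρ : ∀ e, Integrable (ρ e)) {lam : ℝ} {u : G.H1} :
    IsSolution p W ρ lam u ↔ ∀ φ, energy W hW u φ + lam * l2 u φ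
      = mass (nlWeight p ρ u) (integrable_nlWeight hp hρ u) u φ := by
  simp only [← energy_add_const]
  simp only [IsSolution, energy_eq_integral, mass_apply, nlWeight]

lemma quadForm_eq {p : ℝ} (hp : 2 < p) {W ρ : ∀ e, G.Edge e → ℝ}
    (hW : ∀ e, Integrable (W e)) (hρ : ∀ e, Integrable (ρ e)) (lam : ℝ) (u φ : G.H1) :
    quadForm p W ρ lam u φ = energy W hW φ φ + lam * l2 φ φ
      - (p - 1) * mass (nlWeight p ρ u) (integrable_nlWeight hp hρ u) φ φ := by
  have hi := integrable_weight_add_const hW lam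
  rw [← energy_add_const, energy_eq_integral, mass_apply, ← integral_const_mul, ← integral_sub]
  · rw [quadForm]; congr! 3; simp only [nlWeight]; ring
  · exact fun e => (integrable_der_mul φ φ e).add (integrable_mass hi φ φ e)
  · exact fun e => (integrable_mass (integrable_nlWeight hp hρ u) φ φ e).const_mul _

/-- A weight bounded below and a pointwise positive lower bound give positivity of the mass. -/
lemma integral_pos_of_weight {c : ∀ e, G.Edge e → ℝ} (hc : ∀ e, Integrable (c e)) {b : ℝ}
    (hb : 0 < b) (hcb : ∀ e, ∀ᵐ x, b ≤ c e x) (f : ∀ e, C(G.Edge e, ℝ)) (hf : ∀ e x, 0 ≤ f e x)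
    {e₀ : E} {x₀ : G.Edge e₀} (h : f e₀ x₀ ≠ 0) : 0 < integral fun e x => c e x * f e x := by
  have hfi : ∀ e, Integrable (f e) := fun e =>
    ((integrable_weight_mul (integrable_one e) (f e))).congr (Eventually.of_forall fun x => by simp)
  have h1 : 0 < integral fun e x => b * f e x := by
    rw [integral_const_mul]
    refine mul_pos hb (Finset.sum_pos' (fun e _ => MeasureTheory.integral_nonneg (hf e))
      ⟨e₀, Finset.mem_univ _, ?_⟩)
    exact integral_pos_of_integrable_nonneg_nonzero (f e₀).continuous (hfi e₀) (hf e₀) h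
  refine h1.trans_le (integral_mono (fun e => (hfi e).const_mul b)
    (fun e => integrable_weight_mul (hc e) (f e)) fun e => ?_)
  filter_upwards [hcb e] with x hx using mul_le_mul_of_nonneg_right hx (hf e x)

lemma l2_self_pos {u : G.H1} (hu : u ≠ 0) : 0 < l2 u u := by
  obtain ⟨e, x, h⟩ := exists_val_ne_zero hu
  have := integral_pos_of_weight (G := G) (c := fun _ _ => 1) integrable_one zero_lt_one
    (fun e => Eventually.of_forall fun x => le_rfl) (fun e => u.1.1 e * u.1.1 e)
    (fun e x => mul_self_nonneg _) (e₀ := e) (x₀ := x) (mul_self_ne_zero.2 h)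
  rw [l2_apply]
  simpa [H1.val] using this

end CompactMetricGraph

end

/-! ### Completeness, compactness and existence of minimisers -/

noncomputable section

open MeasureTheory Filter Topology

namespace CompactMetricGraph

variable {V E : Type*} {G : CompactMetricGraph V E}

/-- Cauchy–Schwarz against the indicator of (y, x]. This 1/2-Hölder bound provides the
equicontinuity for Arzelà–Ascoli. -/
lemma HasL2Deriv.abs_sub_le {e : E} {u : C(G.Edge e, ℝ)}
    {g : Lp ℝ 2 (volume : Measure (G.Edge e))} (h : G.HasL2Deriv u g) (x y : G.Edge e) :
    |u x - u y| ≤ ‖g‖ * √|(x : ℝ) - y| := by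
  wlog hyx : y ≤ x generalizing x y
  · rw [abs_sub_comm (u x), abs_sub_comm (x : ℝ)]
    exact this y x (le_of_not_ge hyx)
  have hg : Integrable g volume := (Lp.memLp g).integrable (by norm_num)
  have h1 : u x - u y = ∫ z in Set.Ioc y x, g z := by
    rw [h x, h y, add_sub_add_left_eq_sub, sub_eq_iff_eq_add', ← setIntegral_union]
    · rw [Set.Iic_union_Ioc_eq_Iic hyx]
    · exact Set.disjoint_left.2 fun z hz hz' => not_lt.2 hz hz'.1
    · exact measurableSet_Ioc
    · exact hg.integrableOn
    · exact hg.integrableOn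
  have hvol : volume.real (Set.Ioc y x) = (x : ℝ) - y := by
    have : (Set.Ioc y x) = ((↑) ⁻¹' Set.Ioc (y : ℝ) x : Set (G.Edge e)) := by
      ext z; simp
    rw [Measure.real, this, volume_edge_preimage measurableSet_Ioc, Real.volume_Ioc,
      ENNReal.toReal_ofReal (sub_nonneg.2 hyx)]
    exact fun z hz => ⟨y.2.1.trans hz.1.le, hz.2.trans x.2.2⟩
  have hfin : volume (Set.Ioc y x) ≠ ⊤ := measure_ne_top _ _
  rw [h1, ← L2.inner_indicatorConstLp_one (𝕜 := ℝ) measurableSet_Ioc hfin g, mul_comm]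
  refine (abs_real_inner_le_norm _ _).trans ?_
  rw [norm_indicatorConstLp (by norm_num) (by norm_num), hvol,
    abs_of_nonneg (sub_nonneg.2 (show (y : ℝ) ≤ x from hyx)), Real.sqrt_eq_rpow]
  simp

lemma volume_real_univ (e : E) : volume.real (Set.univ : Set (G.Edge e)) = G.length e := by
  have := volume_edge_preimage (G := G) (e := e) measurableSet_Icc subset_rfl
  rw [Measure.real, show (Set.univ : Set (G.Edge e)) = (↑) ⁻¹' Set.Icc (0 : ℝ) (G.length e) by
    ext z; simp, this, Real.volume_Icc, sub_zero,
    ENNReal.toReal_ofReal (G.length_pos e).le]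

lemma isClosed_hasL2Deriv (e : E) : IsClosed {q : C(G.Edge e, ℝ) ×
    Lp ℝ 2 (volume : Measure (G.Edge e)) | G.HasL2Deriv q.1 q.2} := by
  simp only [HasL2Deriv, Set.ofPred_forall]
  refine isClosed_iInter fun x => isClosed_eq ?_ ?_
  · exact (ContinuousEvalConst.continuous_eval_const x).comp continuous_fst
  · refine ((ContinuousEvalConst.continuous_eval_const _).comp continuous_fst).add ?_
    have : ∀ g : Lp ℝ 2 (volume : Measure (G.Edge e)), ∫ y in Set.Iic x, g y
        = inner ℝ (indicatorConstLp 2 (measurableSet_Iic (a := x)) (measure_ne_top volume _) (1 : ℝ)) g :=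
      fun g => (L2.inner_indicatorConstLp_one (𝕜 := ℝ) _ _ g).symm
    simp only [this]
    exact continuous_const.inner continuous_snd

/-- Eliminates the existential over vertex values: equalities between edge values visibly define a
closed set. The default 0 is used only at vertices without edges, where nothing is required. -/
lemma continuousAtVertices_iff (u : ∀ e, C(G.Edge e, ℝ)) : G.ContinuousAtVertices u ↔
    (∀ e e', G.src e = G.src e' → u e (G.left e) = u e' (G.left e')) ∧
    (∀ e e', G.tgt e = G.tgt e' → u e (G.right e) = u e' (G.right e')) ∧
    (∀ e e', G.src e = G.tgt e' → u e (G.left e) = u e' (G.right e')) := by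
  classical
  constructor
  · rintro ⟨c, hc⟩
    refine ⟨fun e e' h => ?_, fun e e' h => ?_, fun e e' h => ?_⟩ <;> simp [hc, h]
  · rintro ⟨h1, h2, h3⟩
    refine ⟨fun v => if h : ∃ e, G.src e = v then u h.choose (G.left _) else
      if h : ∃ e, G.tgt e = v then u h.choose (G.right _) else 0, fun e => ⟨?_, ?_⟩⟩
    · have h : ∃ e', G.src e' = G.src e := ⟨e, rfl⟩
      simp only [dif_pos h]
      exact h1 _ _ h.choose_spec.symm
    · by_cases h : ∃ e', G.src e' = G.tgt e
      · simp only [dif_pos h]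
        exact (h3 _ _ h.choose_spec).symm
      · have h' : ∃ e', G.tgt e' = G.tgt e := ⟨e, rfl⟩
        simp only [dif_neg h, dif_pos h']
        exact h2 _ _ h'.choose_spec.symm

lemma isClosed_H1 : IsClosed (G.H1 : Set ((∀ e, C(G.Edge e, ℝ)) ×
    (∀ e, Lp ℝ 2 (volume : Measure (G.Edge e))))) := by
  have hev : ∀ e (x : G.Edge e), Continuous fun f : (∀ e, C(G.Edge e, ℝ)) ×
      (∀ e, Lp ℝ 2 (volume : Measure (G.Edge e))) => f.1 e x := fun e x =>
    (ContinuousEvalConst.continuous_eval_const x).comp ((continuous_apply e).comp continuous_fst)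
  refine IsClosed.inter (s₁ := {f : (∀ e, C(G.Edge e, ℝ)) ×
      (∀ e, Lp ℝ 2 (volume : Measure (G.Edge e))) | ∀ e, G.HasL2Deriv (f.1 e) (f.2 e)})
    (s₂ := {f : (∀ e, C(G.Edge e, ℝ)) ×
      (∀ e, Lp ℝ 2 (volume : Measure (G.Edge e))) | G.ContinuousAtVertices f.1}) ?_ ?_
  · rw [Set.ofPred_forall]
    refine isClosed_iInter fun e => ?_
    have hcont : Continuous fun f : (∀ e, C(G.Edge e, ℝ)) ×
        (∀ e, Lp ℝ 2 (volume : Measure (G.Edge e))) => (f.1 e, f.2 e) := by fun_prop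
    exact (isClosed_hasL2Deriv e).preimage hcont
  · simp only [continuousAtVertices_iff, Set.ofPred_and, Set.ofPred_forall]
    refine IsClosed.inter ?_ (IsClosed.inter ?_ ?_) <;>
    exact isClosed_iInter fun e => isClosed_iInter fun e' => isClosed_iInter fun _ =>
      isClosed_eq (hev _ _) (hev _ _)

/-- The norm is inherited from the product of sup norms of the functions and L² norms of the
derivatives; a closed subspace of a Banach space is complete. -/
instance : CompleteSpace G.H1 := by
  have : Fact ((1 : ENNReal) ≤ 2) := ⟨by norm_num⟩
  exact isClosed_H1.completeSpace_coe

/-- Both conditions are pointwise closed, so the set is compact for pointwise convergence by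
Tychonoff; equicontinuity upgrades this to uniform convergence. -/
lemma isCompact_holder_ball (e : E) (M R : ℝ) : IsCompact {f : C(G.Edge e, ℝ) |
    (∀ x, f x ∈ Set.Icc (-M) M) ∧ ∀ x y, |f x - f y| ≤ R * √|(x : ℝ) - y|} := by
  apply ArzelaAscoli.isCompact_of_equicontinuous
  · have : ContinuousMap.toFun '' {f : C(G.Edge e, ℝ) |
        (∀ x, f x ∈ Set.Icc (-M) M) ∧ ∀ x y, |f x - f y| ≤ R * √|(x : ℝ) - y|}
        = (Set.pi Set.univ fun _ => Set.Icc (-M) M) ∩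
          {f : G.Edge e → ℝ | ∀ x y, |f x - f y| ≤ R * √|(x : ℝ) - y|} := by
      ext f
      constructor
      · rintro ⟨g, hg, rfl⟩
        exact ⟨fun x _ => hg.1 x, hg.2⟩
      · rintro ⟨h1, h2⟩
        have hcont : Continuous f := by
          refine continuous_iff_continuousAt.2 fun x => ?_
          rw [ContinuousAt, tendsto_iff_dist_tendsto_zero]
          have hlim : Tendsto (fun y : G.Edge e => R * √|(y : ℝ) - x|) (𝓝 x) (𝓝 0) := by
            have : Continuous fun y : G.Edge e => R * √|(y : ℝ) - x| := by fun_prop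
            simpa using this.tendsto x
          exact squeeze_zero (fun _ => dist_nonneg) (fun y => h2 y x) hlim
        exact ⟨⟨f, hcont⟩, ⟨fun x => h1 x trivial, h2⟩, rfl⟩
    rw [this]
    refine (isCompact_univ_pi fun _ => isCompact_Icc).inter_right ?_
    simp only [Set.ofPred_forall]
    exact isClosed_iInter fun x => isClosed_iInter fun y => isClosed_le
      ((continuous_apply x).sub (continuous_apply y)).abs continuous_const
  · intro x
    rw [Metric.equicontinuousAt_iff]
    intro ε hε
    have hlim : Tendsto (fun y : G.Edge e => R * √|(x : ℝ) - y|) (𝓝 x) (𝓝 0) := by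
      have : Continuous fun y : G.Edge e => R * √|(x : ℝ) - y| := by fun_prop
      simpa using this.tendsto x
    obtain ⟨δ, hδ, h⟩ := Metric.eventually_nhds_iff.1 (hlim.eventually_lt_const hε)
    exact ⟨δ, hδ, fun y hy f => (f.2.2 x y).trans_lt (h hy)⟩

variable [Fintype E]

lemma continuous_dirichlet_self : Continuous fun u : G.H1 => dirichlet u u := by
  simp only [dirichlet_apply]
  refine continuous_finsetSum _ fun e _ => ?_
  have : Continuous fun u : G.H1 => u.1.2 e :=
    (continuous_apply e).comp (continuous_snd.comp continuous_subtype_val)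
  exact this.inner this

lemma continuous_mass_self {c : ∀ e, G.Edge e → ℝ} (hc : ∀ e, Integrable (c e)) :
    Continuous fun u : G.H1 => mass c hc u u := by
  have h : ∀ u : G.H1, mass c hc u u = ∑ e, ∫ x, c e x * (u.1.1 e * u.1.1 e) x := fun u =>
    Finset.sum_congr rfl fun e _ => by simp [H1.val, mul_assoc]
  simp only [h]
  refine continuous_finsetSum _ fun e _ => (continuous_integral_weight (hc e)).comp ?_
  have : Continuous fun u : G.H1 => u.1.1 e :=
    (continuous_apply e).comp (continuous_fst.comp continuous_subtype_val)
  exact this.mul this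

lemma continuous_mass_left {c : ∀ e, G.Edge e → ℝ} (hc : ∀ e, Integrable (c e)) (v : G.H1) :
    Continuous fun u : G.H1 => mass c hc u v := by
  have h : ∀ u : G.H1, mass c hc u v = ∑ e, ∫ x, c e x * (u.1.1 e * v.1.1 e) x := fun u =>
    Finset.sum_congr rfl fun e _ => by simp [H1.val, mul_assoc]
  simp only [h]
  refine continuous_finsetSum _ fun e _ => (continuous_integral_weight (hc e)).comp ?_
  have : Continuous fun u : G.H1 => u.1.1 e :=
    (continuous_apply e).comp (continuous_fst.comp continuous_subtype_val)
  exact this.mul continuous_const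

lemma continuous_energy_self {c : ∀ e, G.Edge e → ℝ} (hc : ∀ e, Integrable (c e)) :
    Continuous fun u : G.H1 => energy c hc u u := by
  simp only [energy_apply]
  exact continuous_dirichlet_self.add (continuous_mass_self hc)

/-- One-dimensional Sobolev inequality: compare u(x) with u(y) by the Hölder bound and integrate
over y in the edge. -/
lemma length_mul_val_sq_le (u : G.H1) (e : E) (x : G.Edge e) :
    G.length e * H1.val u e x ^ 2 ≤ 2 * l2 u u + 2 * G.length e ^ 2 * dirichlet u u := by
  have hL := G.length_pos e
  have hD := norm_der_sq_le u e
  have hpt : ∀ y, H1.val u e x ^ 2 ≤ 2 * (H1.val u e y * H1.val u e y)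
      + 2 * G.length e * dirichlet u u := by
    intro y
    have h1 := (u.2.1 e).abs_sub_le x y
    have h2 : |u.1.1 e x - u.1.1 e y| ^ 2 ≤ (‖u.1.2 e‖ * √|(x : ℝ) - y|) ^ 2 :=
      pow_le_pow_left₀ (abs_nonneg _) h1 2
    rw [sq_abs, mul_pow, Real.sq_sqrt (abs_nonneg _)] at h2
    have h3 : |(x : ℝ) - y| ≤ G.length e := by
      rw [abs_le]; constructor <;> linarith [x.2.1, x.2.2, y.2.1, y.2.2]
    have h4 : ‖u.1.2 e‖ ^ 2 * |(x : ℝ) - y| ≤ dirichlet u u * G.length e :=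
      mul_le_mul hD h3 (abs_nonneg _) (dirichlet_self_nonneg u)
    have h5 : (u.1.1 e x - u.1.1 e y) ^ 2 = (H1.val u e x - H1.val u e y) ^ 2 := rfl
    -- The square equals 2u(y)² + 2(u(x) − u(y))² − u(x)².
    nlinarith [sq_nonneg (H1.val u e x - 2 * H1.val u e y)]
  have hint : Integrable fun y => H1.val u e y * H1.val u e y :=
    (integrable_mass integrable_one u u e).congr (Eventually.of_forall fun y => by simp)
  have h1 := MeasureTheory.integral_mono (integrable_const (H1.val u e x ^ 2))
    ((hint.const_mul 2).add (integrable_const (2 * G.length e * dirichlet u u))) hpt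
  simp only [Pi.add_apply] at h1
  rw [MeasureTheory.integral_add (hint.const_mul 2) (integrable_const _), MeasureTheory.integral_const,
    MeasureTheory.integral_const, MeasureTheory.integral_const_mul, volume_real_univ] at h1
  have h2 : ∫ y, H1.val u e y * H1.val u e y ≤ l2 u u := by
    rw [l2_apply]
    exact Finset.single_le_sum (f := fun e => ∫ y, H1.val u e y * H1.val u e y)
      (fun e _ => MeasureTheory.integral_nonneg fun y => mul_self_nonneg _) (Finset.mem_univ e)
  simp only [smul_eq_mul] at h1
  nlinarith

/-- A sequence bounded in `H¹` has a uniformly convergent subsequence. -/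
lemma exists_subseq_tendsto_val (u : ℕ → G.H1) {R : ℝ}
    (hR : ∀ n, dirichlet (u n) (u n) + l2 (u n) (u n) ≤ R) :
    ∃ U : ∀ e, C(G.Edge e, ℝ), ∃ σ : ℕ → ℕ, StrictMono σ ∧
      Tendsto (fun n => (u (σ n)).1.1) atTop (𝓝 U) := by
  let M : E → ℝ := fun e => √((2 * R + 2 * G.length e ^ 2 * R) / G.length e)
  have hK : IsCompact (Set.pi Set.univ fun e => {f : C(G.Edge e, ℝ) |
      (∀ x, f x ∈ Set.Icc (-M e) (M e)) ∧ ∀ x y, |f x - f y| ≤ √R * √|(x : ℝ) - y|}) :=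
    isCompact_univ_pi fun e => isCompact_holder_ball e (M e) (√R)
  have hmem : ∀ n, (u n).1.1 ∈ (Set.pi Set.univ fun e => {f : C(G.Edge e, ℝ) |
      (∀ x, f x ∈ Set.Icc (-M e) (M e)) ∧ ∀ x y, |f x - f y| ≤ √R * √|(x : ℝ) - y|}) := by
    intro n e _
    have hD := dirichlet_self_nonneg (u n)
    have hL := l2_self_nonneg (u n)
    refine ⟨fun x => ?_, fun x y => (((u n).2.1 e).abs_sub_le x y).trans ?_⟩
    · rw [Set.mem_Icc, ← abs_le]
      refine Real.abs_le_sqrt ?_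
      rw [le_div_iff₀' (G.length_pos e)]
      refine (length_mul_val_sq_le (u n) e x).trans ?_
      have := hR n
      gcongr <;> linarith
    · gcongr
      refine Real.le_sqrt_of_sq_le ((norm_der_sq_le (u n) e).trans ?_)
      linarith [hR n]
  obtain ⟨U, _, σ, hσ, h⟩ := hK.tendsto_subseq hmem
  exact ⟨U, σ, hσ, h⟩

/-- Uniform convergence together with `L²`-Cauchy derivatives gives convergence in `H¹`. -/
lemma exists_tendsto_of_dirichlet (u : ℕ → G.H1) {U : ∀ e, C(G.Edge e, ℝ)}
    (hU : Tendsto (fun n => (u n).1.1) atTop (𝓝 U))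
    (hD : Tendsto (fun n : ℕ × ℕ => dirichlet (u n.1 - u n.2) (u n.1 - u n.2)) atTop (𝓝 0)) :
    ∃ v : G.H1, v.1.1 = U ∧ Tendsto u atTop (𝓝 v) := by
  have hC : CauchySeq u := by
    rw [cauchySeq_iff_tendsto_dist_atTop_0]
    have h1 := cauchySeq_iff_tendsto_dist_atTop_0.1 hU.cauchySeq
    have h2 := (Real.continuous_sqrt.tendsto 0).comp hD
    rw [Real.sqrt_zero] at h2
    have h3 := h1.add h2
    rw [add_zero] at h3
    refine squeeze_zero (fun _ => dist_nonneg) (fun n => ?_) h3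
    rw [Subtype.dist_eq, Prod.dist_eq]
    refine max_le (le_add_of_nonneg_right (Real.sqrt_nonneg _)) ?_
    refine le_trans ?_ (le_add_of_nonneg_left dist_nonneg)
    refine (dist_pi_le_iff (Real.sqrt_nonneg _)).2 fun e => ?_
    rw [dist_eq_norm]
    exact Real.le_sqrt_of_sq_le (norm_der_sq_le (u n.1 - u n.2) e)
  obtain ⟨v, hv⟩ := cauchySeq_tendsto_of_complete hC
  refine ⟨v, ?_, hv⟩
  have : Tendsto (fun n => (u n).1.1) atTop (𝓝 v.1.1) :=
    ((continuous_fst.comp continuous_subtype_val).tendsto v).comp hv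
  exact tendsto_nhds_unique this hU

/-- The form `energy c` controls the `H¹` norm. -/
def Coercive (c : ∀ e, G.Edge e → ℝ) (hc : ∀ e, Integrable (c e)) : Prop :=
  ∃ α > 0, ∀ u : G.H1, α * (dirichlet u u + l2 u u) ≤ energy c hc u u

lemma Coercive.nonneg {c : ∀ e, G.Edge e → ℝ} {hc : ∀ e, Integrable (c e)}
    (h : Coercive c hc) (u : G.H1) : 0 ≤ energy c hc u u := by
  obtain ⟨α, hα, h⟩ := h
  exact (mul_nonneg hα.le (add_nonneg (dirichlet_self_nonneg u) (l2_self_nonneg u))).trans (h u)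

lemma parallelogram {M : Type*} [AddCommGroup M] [Module ℝ M] (B : LinearMap.BilinForm ℝ M)
    (u v : M) : B (u - v) (u - v) = 2 * B u u + 2 * B v v - B (u + v) (u + v) := by
  simp only [map_add, map_sub, LinearMap.add_apply, LinearMap.sub_apply]; ring

/-- A coercive form attains its minimum relative to a uniformly continuous, `2`-homogeneous
constraint. -/
theorem exists_minimizer {c : ∀ e, G.Edge e → ℝ} {hc : ∀ e, Integrable (c e)}
    (hA : Coercive c hc) (N : (∀ e, C(G.Edge e, ℝ)) → ℝ) (hN : Continuous N)
    (hN2 : ∀ (s : ℝ) f, N (s • f) = s ^ 2 * N f)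
    (K : Submodule ℝ G.H1) (hK : IsClosed (K : Set G.H1)) (hne : ∃ w ∈ K, 0 < N w.1.1) :
    ∃ u ∈ K, N u.1.1 = 1 ∧ ∀ w ∈ K, energy c hc u u * N w.1.1 ≤ energy c hc w w := by
  set A := energy c hc with hAdef
  have hA0 := hA.nonneg
  have hAs : ∀ (s : ℝ) w, A (s • w) (s • w) = s ^ 2 * A w w := fun s w => by
    simp only [map_smul, LinearMap.smul_apply, smul_eq_mul]; ring
  have hscale : ∀ w ∈ K, 0 < N w.1.1 → ∃ s : ℝ, 0 < s ∧ s ^ 2 * N w.1.1 = 1 ∧ s • w ∈ K ∧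
      N (s • w).1.1 = 1 := by
    intro w hw h
    have hs : (√(N w.1.1)⁻¹) ^ 2 * N w.1.1 = 1 := by
      rw [Real.sq_sqrt (inv_nonneg.2 h.le), inv_mul_cancel₀ h.ne']
    exact ⟨√(N w.1.1)⁻¹, Real.sqrt_pos.2 (inv_pos.2 h), hs, K.smul_mem _ hw,
      (hN2 _ w.1.1).trans hs⟩
  set T : Set ℝ := (fun w : G.H1 => A w w) '' {w | w ∈ K ∧ N w.1.1 = 1} with hT
  have hTne : T.Nonempty := by
    obtain ⟨w, hw, h⟩ := hne
    obtain ⟨s, -, -, h1, h2⟩ := hscale w hw h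
    exact ⟨_, s • w, ⟨h1, h2⟩, rfl⟩
  have hTb : BddBelow T := ⟨0, by rintro _ ⟨w, -, rfl⟩; exact hA0 w⟩
  have hS0 : 0 ≤ sInf T := le_csInf hTne (by rintro _ ⟨w, -, rfl⟩; exact hA0 w)
  -- The homogeneous form of the infimum; when N ≤ 0 it holds because the infimum is nonnegative.
  have hSle : ∀ w ∈ K, sInf T * N w.1.1 ≤ A w w := by
    intro w hw
    rcases le_or_gt (N w.1.1) 0 with h | h
    · exact (mul_nonpos_of_nonneg_of_nonpos hS0 h).trans (hA0 w)
    · obtain ⟨s, hs, hs1, h1, h2⟩ := hscale w hw h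
      have := csInf_le hTb ⟨s • w, ⟨h1, h2⟩, rfl⟩
      simp only [hAs] at this
      have h3 := mul_le_mul_of_nonneg_right this h.le
      rwa [mul_right_comm, hs1, one_mul] at h3
  obtain ⟨t, -, ht, htT⟩ := exists_seq_tendsto_sInf hTne hTb
  choose u hu hut using htT
  obtain ⟨α, hα, hco⟩ := hA
  obtain ⟨B, hB⟩ := ht.bddAbove_range
  obtain ⟨U, σ, hσ, hU⟩ := exists_subseq_tendsto_val u (R := B / α) (fun n => by
    rw [le_div_iff₀' hα]
    refine (hco (u n)).trans ?_
    have : A (u n) (u n) = t n := hut n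
    rw [this]
    exact hB ⟨n, rfl⟩)
  have hNU : N U = 1 := by
    refine tendsto_nhds_unique ((hN.tendsto U).comp hU) ?_
    simp only [Function.comp_def, (hu _).2]
    exact tendsto_const_nhds
  have hAσ : Tendsto (fun n => A (u (σ n)) (u (σ n))) atTop (𝓝 (sInf T)) := by
    have := ht.comp hσ.tendsto_atTop
    exact this.congr fun n => (hut _).symm
  have hfst : Tendsto (Prod.fst : ℕ × ℕ → ℕ) atTop atTop := by
    rw [← prod_atTop_atTop_eq]; exact tendsto_fst
  have hsnd : Tendsto (Prod.snd : ℕ × ℕ → ℕ) atTop atTop := by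
    rw [← prod_atTop_atTop_eq]; exact tendsto_snd
  -- N depends only on the values and is 2-homogeneous, so the limit is N(2U) = 4 N(U) = 4.
  have hNsum : Tendsto (fun n : ℕ × ℕ => N ((u (σ n.1)) + (u (σ n.2))).1.1) atTop (𝓝 4) := by
    have h1 := (hN.tendsto (U + U)).comp ((hU.comp hfst).add (hU.comp hsnd))
    rw [← two_smul ℝ U, hN2, hNU] at h1
    norm_num at h1
    exact h1
  -- By the parallelogram law, A(uᵢ − uⱼ) ≤ 2A(uᵢ) + 2A(uⱼ) − S·N(uᵢ + uⱼ), where S is the infimum.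
  -- The right side tends to 4S − 4S = 0, and coercivity passes this on to the derivatives.
  have hD : Tendsto (fun n : ℕ × ℕ => dirichlet (u (σ n.1) - u (σ n.2)) (u (σ n.1) - u (σ n.2)))
      atTop (𝓝 0) := by
    have hlim : Tendsto (fun n : ℕ × ℕ => α⁻¹ * (2 * A (u (σ n.1)) (u (σ n.1))
        + 2 * A (u (σ n.2)) (u (σ n.2)) - sInf T * N ((u (σ n.1)) + (u (σ n.2))).1.1))
        atTop (𝓝 0) := by
      have := ((((hAσ.comp hfst).const_mul 2).add ((hAσ.comp hsnd).const_mul 2)).sub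
        (hNsum.const_mul (sInf T))).const_mul α⁻¹
      rw [show α⁻¹ * (2 * sInf T + 2 * sInf T - sInf T * 4) = 0 by ring] at this
      exact this
    refine squeeze_zero (fun n => dirichlet_self_nonneg _) (fun n => ?_) hlim
    rw [← div_eq_inv_mul, le_div_iff₀' hα]
    have h1 := hco (u (σ n.1) - u (σ n.2))
    have h2 := hSle (u (σ n.1) + u (σ n.2)) (K.add_mem (hu _).1 (hu _).1)
    have h3 := parallelogram A (u (σ n.1)) (u (σ n.2))
    have h4 := mul_nonneg hα.le (l2_self_nonneg (u (σ n.1) - u (σ n.2)))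
    rw [mul_add] at h1
    linarith
  obtain ⟨v, hvU, hv⟩ := exists_tendsto_of_dirichlet (fun n => u (σ n)) hU hD
  have hAv : A v v = sInf T :=
    tendsto_nhds_unique (((continuous_energy_self hc).tendsto v).comp hv) hAσ
  refine ⟨v, hK.mem_of_tendsto hv (Eventually.of_forall fun n => (hu _).1), hvU ▸ hNU, ?_⟩
  rw [hAv]
  exact hSle

end CompactMetricGraph

end

/-! ### Absolute continuity, composition with Lipschitz functions, infinite dimension -/

noncomputable section

open MeasureTheory Filter Topology

namespace CompactMetricGraph

variable {V E : Type*} {G : CompactMetricGraph V E}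

lemma map_coe_volume (e : E) : (volume : Measure (G.Edge e)).map (↑)
    = (volume : Measure ℝ).restrict (Set.Icc 0 (G.length e)) :=
  MeasurableSet.map_coe_volume measurableSet_Icc

lemma setIntegral_Iic_eq {e : E} {g : G.Edge e → ℝ} {g' : ℝ → ℝ}
    (h : ∀ y : G.Edge e, g' y = g y) (x : G.Edge e) :
    ∫ y in Set.Iic x, g y = ∫ t in (0 : ℝ)..x, g' t := by
  have h1 : ∫ y in Set.Iic x, g y = ∫ y in ((↑) ⁻¹' Set.Iic (x : ℝ) : Set (G.Edge e)), g' y := by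
    simp only [h]; rfl
  rw [h1, ← (MeasurableEmbedding.subtype_coe measurableSet_Icc).setIntegral_map, map_coe_volume,
    Measure.restrict_restrict measurableSet_Iic, intervalIntegral.integral_of_le x.2.1,
    ← integral_Icc_eq_integral_Ioc]
  congr 2
  ext t
  exact ⟨fun ht => ⟨ht.2.1, ht.1⟩, fun ht => ⟨ht.2, ht.1, ht.2.trans x.2.2⟩⟩

lemma ae_edge_of_ae {e : E} {P : ℝ → Prop} (h : ∀ᵐ t, t ∈ Set.Icc 0 (G.length e) → P t) :
    ∀ᵐ x : G.Edge e, P x :=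
  (ae_restrict_iff_subtype measurableSet_Icc).1 ((ae_restrict_iff' measurableSet_Icc).2 h)

lemma ae_mem_Ioo (e : E) : ∀ᵐ x : G.Edge e, (x : ℝ) ∈ Set.Ioo 0 (G.length e) := by
  refine ae_edge_of_ae ?_
  filter_upwards [Measure.ae_ne volume 0, Measure.ae_ne volume (G.length e)] with t h0 h1 ht
  exact ⟨lt_of_le_of_ne ht.1 h0.symm, lt_of_le_of_ne ht.2 h1⟩

/-- A function on an edge with an `L²` derivative extends to the line as an absolutely continuous
function that is almost everywhere differentiable. -/
lemma HasL2Deriv.exists_absolutelyContinuous {e : E} {u : C(G.Edge e, ℝ)}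
    {g : Lp ℝ 2 (volume : Measure (G.Edge e))} (h : G.HasL2Deriv u g) :
    ∃ U : ℝ → ℝ, AbsolutelyContinuousOnInterval U 0 (G.length e) ∧
      (∀ x : G.Edge e, U x = u x) ∧ ∀ᵐ x : G.Edge e, HasDerivAt U (g x) x := by
  have hg : Integrable g volume := (Lp.memLp g).integrable (by norm_num)
  have hℓ := (G.length_pos e).le
  set g' : ℝ → ℝ := Set.IccExtend hℓ g with hg'
  have hg'c : ∀ y : G.Edge e, g' y = g y := fun y => Set.IccExtend_val hℓ g y
  have hint : IntervalIntegrable g' volume 0 (G.length e) := by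
    rw [intervalIntegrable_iff_integrableOn_Icc_of_le hℓ, IntegrableOn, ← map_coe_volume,
      (MeasurableEmbedding.subtype_coe measurableSet_Icc).integrable_map_iff]
    exact hg.congr (Eventually.of_forall fun y => (hg'c y).symm)
  refine ⟨fun t => u (G.left e) + ∫ s in (0 : ℝ)..t, g' s, ?_, fun x => ?_, ?_⟩
  · have hc : AbsolutelyContinuousOnInterval (fun _ : ℝ => u (G.left e)) 0 (G.length e) :=
      ((LipschitzWith.const (u (G.left e))).lipschitzOnWith
        (s := Set.uIcc 0 (G.length e))).absolutelyContinuousOnInterval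
    exact hc.add (hint.absolutelyContinuousOnInterval_intervalIntegral Set.left_mem_uIcc)
  · rw [h x, setIntegral_Iic_eq hg'c x]
  · have := ae_edge_of_ae (G := G) (e := e) (P := fun t =>
      HasDerivAt (fun t => u (G.left e) + ∫ s in (0 : ℝ)..t, g' s) (g' t) t) (by
      filter_upwards [hint.ae_hasDerivAt_integral] with t ht htm
      rw [Set.uIcc_of_le hℓ] at ht
      exact (ht htm 0 ⟨le_rfl, hℓ⟩).const_add _)
    filter_upwards [this] with x hx
    rwa [hg'c] at hx

/-- Converse of `HasL2Deriv.exists_absolutelyContinuous`, by the fundamental theorem of calculus for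
absolutely continuous functions. -/
lemma hasL2Deriv_of_absolutelyContinuous {e : E} {U : ℝ → ℝ}
    (hU : AbsolutelyContinuousOnInterval U 0 (G.length e)) {f : C(G.Edge e, ℝ)}
    (hf : ∀ x : G.Edge e, U x = f x)
    (hd : MemLp (fun x : G.Edge e => deriv U x) 2 volume) : G.HasL2Deriv f hd.toLp := by
  intro x
  rw [integral_congr_ae (ae_restrict_of_ae hd.coeFn_toLp), setIntegral_Iic_eq (g' := deriv U)
    (fun _ => rfl) x, AbsolutelyContinuousOnInterval.integral_deriv_eq_sub, hf x]
  · have : U 0 = f (G.left e) := hf (G.left e)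
    rw [this]; ring
  · refine hU.mono ?_
    rw [Set.uIcc_of_le x.2.1, Set.uIcc_of_le (G.length_pos e).le]
    exact Set.Icc_subset_Icc_right x.2.2

lemma _root_.LipschitzOnWith.comp_absolutelyContinuousOnInterval {F U : ℝ → ℝ} {K : NNReal}
    {s : Set ℝ} {a b : ℝ} (hF : LipschitzOnWith K F s) (hU : AbsolutelyContinuousOnInterval U a b)
    (hs : Set.MapsTo U (Set.uIcc a b) s) : AbsolutelyContinuousOnInterval (F ∘ U) a b := by
  rw [absolutelyContinuousOnInterval_iff] at hU ⊢
  intro ε hε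
  -- Division by K + 1 rather than K allows K = 0.
  obtain ⟨δ, hδ, h⟩ := hU (ε / (K + 1)) (by positivity)
  refine ⟨δ, hδ, fun I hI hI' => ?_⟩
  have h1 := h I hI hI'
  rw [lt_div_iff₀ (by positivity)] at h1
  refine lt_of_le_of_lt ?_ h1
  rw [Finset.sum_mul]
  refine Finset.sum_le_sum fun i hi => ?_
  have := hI.1 i hi
  calc dist ((F ∘ U) (I.2 i).1) ((F ∘ U) (I.2 i).2)
      ≤ K * dist (U (I.2 i).1) (U (I.2 i).2) := hF.dist_le_mul _ (hs this.1) _ (hs this.2)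
    _ ≤ dist (U (I.2 i).1) (U (I.2 i).2) * (K + 1) := by
        rw [mul_comm]
        exact mul_le_mul_of_nonneg_left (by linarith) dist_nonneg

/-- Where the composite is differentiable, compare difference quotients. Elsewhere `deriv` takes the
value 0, so no almost everywhere chain rule for Lipschitz F is needed. -/
lemma abs_deriv_comp_le {F U : ℝ → ℝ} {K : NNReal} {s : Set ℝ} (hF : LipschitzOnWith K F s)
    {d t : ℝ} (hU : HasDerivAt U d t) (hs : ∀ᶠ y in 𝓝 t, U y ∈ s) :
    |deriv (F ∘ U) t| ≤ K * |d| := by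
  by_cases hd : DifferentiableAt ℝ (F ∘ U) t
  · have h1 := (hd.hasDerivAt.tendsto_slope).abs
    have h2 := ((hU.tendsto_slope).abs).const_mul (K : ℝ)
    refine le_of_tendsto_of_tendsto h1 h2 ?_
    filter_upwards [hs.filter_mono nhdsWithin_le_nhds] with y hy
    have h3 := hF.dist_le_mul _ hy _ hs.self_of_nhds
    rw [Real.dist_eq, Real.dist_eq] at h3
    simp only [slope_def_field, Function.comp_apply, abs_div]
    rw [← mul_div_assoc]
    gcongr
  · rw [deriv_zero_of_not_differentiableAt hd, abs_zero]
    positivity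

/-- Composition of an `H¹` function with a Lipschitz function. -/
theorem exists_comp (u : G.H1) {F : ℝ → ℝ} {s : Set ℝ} (hs : ∀ e x, H1.val u e x ∈ s)
    {K : NNReal} (hF : LipschitzOnWith K F s) : ∃ v : G.H1,
      (∀ e x, H1.val v e x = F (H1.val u e x)) ∧
      (∀ e, ∀ᵐ x, |H1.der v e x| ≤ K * |H1.der u e x|) ∧
      ∀ F' : ℝ → ℝ, (∀ y ∈ s, HasDerivAt F (F' y) y) →
        ∀ e, ∀ᵐ x, H1.der v e x = F' (H1.val u e x) * H1.der u e x := by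
  choose U hUac hUval hUder using fun e => (u.2.1 e).exists_absolutelyContinuous
  have hmaps : ∀ e, Set.MapsTo (U e) (Set.uIcc 0 (G.length e)) s := by
    intro e t ht
    rw [Set.uIcc_of_le (G.length_pos e).le] at ht
    rw [hUval e ⟨t, ht⟩]
    exact hs e ⟨t, ht⟩
  have hle : ∀ e, ∀ᵐ x : G.Edge e, |deriv (F ∘ U e) x| ≤ K * |H1.der u e x| := by
    intro e
    -- The values are known to lie in `s` only over the edge, so the neighbourhood of x must stay
    -- inside it; the endpoints are null.
    filter_upwards [hUder e, ae_mem_Ioo e] with x hx hxm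
    refine abs_deriv_comp_le hF hx ?_
    filter_upwards [Icc_mem_nhds hxm.1 hxm.2] with y hy
    exact hmaps e (by rwa [Set.uIcc_of_le (G.length_pos e).le])
  have hmem : ∀ e, MemLp (fun x : G.Edge e => deriv (F ∘ U e) x) 2 volume := fun e =>
    MemLp.of_le_mul (c := K) (memLp_der u e)
      ((measurable_deriv _).comp measurable_subtype_coe).aestronglyMeasurable (hle e)
  let f : ∀ e, C(G.Edge e, ℝ) := fun e => ⟨fun x => F (H1.val u e x),
    hF.continuousOn.comp_continuous (continuous_val u e) (hs e)⟩
  have hfU : ∀ e (x : G.Edge e), (F ∘ U e) x = f e x := fun e x => congrArg F (hUval e x)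
  let v : G.H1 := ⟨(f, fun e => (hmem e).toLp), fun e => hasL2Deriv_of_absolutelyContinuous
    (hF.comp_absolutelyContinuousOnInterval (hUac e) (hmaps e)) (hfU e) (hmem e), by
      obtain ⟨c, hc⟩ := u.2.2
      exact ⟨fun a => F (c a), fun e => ⟨congrArg F (hc e).1, congrArg F (hc e).2⟩⟩⟩
  have hder : ∀ e, ∀ᵐ x : G.Edge e, H1.der v e x = deriv (F ∘ U e) x := fun e =>
    (hmem e).coeFn_toLp
  refine ⟨v, fun e x => rfl, fun e => ?_, fun F' hF' e => ?_⟩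
  · filter_upwards [hder e, hle e] with x h1 h2
    rwa [h1]
  · filter_upwards [hder e, hUder e] with x h1 h2
    rw [h1]
    have h3 : HasDerivAt F (F' (H1.val u e x)) (U e x) := by
      rw [hUval e x]; exact hF' _ (hs e x)
    exact (h3.comp (x : ℝ) h2).deriv

/-- A polynomial on an edge that vanishes at both ends, extended by zero, lies in `H¹`. -/
lemma single_polynomial_mem [DecidableEq E] (e₀ : E) (Q : Polynomial ℝ) (h0 : Q.eval 0 = 0)
    (h1 : Q.eval (G.length e₀) = 0) :
    ∃ v : G.H1, v.1.1 = Pi.single e₀ (Q.toContinuousMapOn (Set.Icc 0 (G.length e₀))) := by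
  have hac : AbsolutelyContinuousOnInterval (fun t => Q.eval t) 0 (G.length e₀) :=
    (ContDiff.contDiffOn (by simpa using Q.contDiff_aeval (𝕜 := ℝ) (R := ℝ) 1)).absolutelyContinuousOnInterval
  have hmem : MemLp (fun x : G.Edge e₀ => deriv (fun t => Q.eval t) x) 2 volume := by
    simp only [Polynomial.deriv]
    have hc : Continuous fun x : G.Edge e₀ => Q.derivative.eval (x : ℝ) :=
      Q.derivative.continuous.comp continuous_subtype_val
    exact (ContinuousMap.toLp 2 volume ℝ ⟨_, hc⟩ |> Lp.memLp).ae_eq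
      (ContinuousMap.coeFn_toLp (𝕜 := ℝ) volume ⟨_, hc⟩)
  refine ⟨⟨(Pi.single e₀ (Q.toContinuousMapOn _), Pi.single e₀ hmem.toLp), fun e => ?_, 0,
    fun e => ?_⟩, rfl⟩
  · by_cases h : e = e₀
    · subst h
      simp only [Pi.single_eq_same]
      exact hasL2Deriv_of_absolutelyContinuous hac (fun x => rfl) hmem
    · simp only [Pi.single_eq_of_ne h]
      exact G.hasL2Deriv_zero e
  · by_cases h : e = e₀
    · subst h
      simp [left, right, h0, h1]
    · simp [Pi.single_eq_of_ne h]

/-- Multiplication by x(ℓ − x) and extension by zero embed the polynomials. This leaves room for a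
new eigenfunction outside any finite-dimensional spectral space. -/
theorem not_finite_H1 [Nonempty E] : ¬ Module.Finite ℝ G.H1 := by
  classical
  intro hfin
  obtain ⟨e₀⟩ := ‹Nonempty E›
  let B : Polynomial ℝ := .X * (.C (G.length e₀) - .X)
  let Φ : Polynomial ℝ →ₗ[ℝ] (∀ e, C(G.Edge e, ℝ)) :=
    (LinearMap.single ℝ (fun e => C(G.Edge e, ℝ)) e₀) ∘ₗ
      (Polynomial.toContinuousMapOnAlgHom (Set.Icc 0 (G.length e₀))).toLinearMap ∘ₗ
      LinearMap.mulLeft ℝ B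
  let S : Submodule ℝ (∀ e, C(G.Edge e, ℝ)) := G.H1.map (LinearMap.fst ℝ _ _)
  have hΦ : ∀ P, Φ P ∈ S := by
    intro P
    obtain ⟨v, hv⟩ := single_polynomial_mem (G := G) e₀ (B * P) (by simp [B]) (by simp [B])
    exact ⟨v.1, v.2, hv⟩
  have hS : Module.Finite ℝ S := Module.Finite.map G.H1 _
  refine Polynomial.not_finite (R := ℝ) (Module.Finite.of_injective (Φ.codRestrict S hΦ) ?_)
  rw [← LinearMap.ker_eq_bot, LinearMap.ker_codRestrict, LinearMap.ker_eq_bot']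
  intro P hP
  have hP' : ∀ x : G.Edge e₀, (B * P).eval (x : ℝ) = 0 := by
    intro x
    have := DFunLike.congr_fun (congrFun hP e₀) x
    simpa [Φ] using this
  have hB : B * P = 0 := by
    refine Polynomial.eq_zero_of_infinite_isRoot _ ((Set.Icc_infinite (G.length_pos e₀)).mono ?_)
    exact fun t ht => hP' ⟨t, ht⟩
  refine (mul_eq_zero.1 hB).resolve_left (mul_ne_zero Polynomial.X_ne_zero ?_)
  exact sub_ne_zero.2 (Polynomial.X_ne_C _).symm

end CompactMetricGraph

end

/-! ### Spectral theory of the linear operator -/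

noncomputable section

open MeasureTheory Filter Topology

namespace CompactMetricGraph

variable {V E : Type*} {G : CompactMetricGraph V E} [Fintype E]

lemma exists_weight_bound {W : ∀ e, G.Edge e → ℝ} (hW : ∀ e, MemLp (W e) ⊤ volume) :
    ∃ M, 0 ≤ M ∧ ∀ e, ∀ᵐ x, |W e x| ≤ M := by
  refine ⟨∑ e, (eLpNormEssSup (W e) volume).toReal,
    Finset.sum_nonneg fun _ _ => ENNReal.toReal_nonneg, fun e => ?_⟩
  filter_upwards [ae_le_eLpNormEssSup (f := W e) (μ := volume)] with x hx
  have hfin : eLpNormEssSup (W e) volume ≠ ⊤ := by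
    have := (hW e).2; rw [eLpNorm_exponent_top] at this; exact this.ne
  have h1 : |W e x| ≤ (eLpNormEssSup (W e) volume).toReal := by
    have := ENNReal.toReal_mono hfin hx
    rwa [toReal_enorm, Real.norm_eq_abs] at this
  exact h1.trans (Finset.single_le_sum
    (f := fun e => (eLpNormEssSup (W e) volume).toReal) (fun _ _ => ENNReal.toReal_nonneg)
    (Finset.mem_univ e))

lemma neg_mul_l2_le_mass {c : ∀ e, G.Edge e → ℝ} (hc : ∀ e, Integrable (c e)) {M : ℝ}
    (hM : ∀ e, ∀ᵐ x, |c e x| ≤ M) (u : G.H1) : -(M * l2 u u) ≤ mass c hc u u := by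
  have h := mass_self_nonneg (integrable_weight_add_const hc M) (fun e => by
    filter_upwards [hM e] with x hx
    linarith [neg_abs_le (c e x)]) u
  rw [mass_add_const hc] at h
  linarith

/-- With δ = μ + λ and k = |M − λ|, the shifted form dominates both δ‖u‖² and ‖u'‖² − k‖u‖².
Weighting these bounds by k + 1 and δ and adding gives δ(‖u'‖² + ‖u‖²). -/
lemma coercive_of_gap {W : ∀ e, G.Edge e → ℝ} (hW : ∀ e, Integrable (W e)) {M : ℝ}
    (hM : ∀ e, ∀ᵐ x, |W e x| ≤ M) {μ lam : ℝ} (hgap : ∀ u : G.H1, μ * l2 u u ≤ energy W hW u u)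
    (h : -μ < lam) :
    Coercive (fun e x => W e x + lam) (integrable_weight_add_const hW lam) := by
  have hδ : 0 < μ + lam := by linarith
  set δ := μ + lam with hδdef
  set k := |M - lam| with hk
  have hk0 : 0 ≤ k := abs_nonneg _
  refine ⟨δ / (δ + k + 1), by positivity, fun u => ?_⟩
  rw [energy_add_const hW, div_mul_eq_mul_div, div_le_iff₀ (by positivity)]
  have h1 := hgap u
  have h2 := neg_mul_l2_le_mass hW hM u
  have h3 := energy_apply hW u u
  have hL := l2_self_nonneg u
  have hA1 : δ * l2 u u ≤ energy W hW u u + lam * l2 u u := by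
    rw [hδdef, add_mul]; linarith
  have hA2 : dirichlet u u - k * l2 u u ≤ energy W hW u u + lam * l2 u u := by
    have := mul_le_mul_of_nonneg_right (le_abs_self (M - lam)) hL
    rw [sub_mul] at this
    linarith
  have h4 := mul_le_mul_of_nonneg_left hA2 hδ.le
  have h5 := mul_le_mul_of_nonneg_left hA1 (by linarith : (0 : ℝ) ≤ k + 1)
  linarith

/-- A nonnegative quadratic in t without constant term has no linear term. This is the
Euler–Lagrange equation of a Rayleigh minimiser. -/
lemma _root_.LinearMap.BilinForm.eq_zero_of_nonneg_line {M : Type*} [AddCommGroup M] [Module ℝ M]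
    {B : LinearMap.BilinForm ℝ M} (hB : ∀ u v, B u v = B v u) {v φ : M} (hv : B v v = 0)
    (h : ∀ t : ℝ, 0 ≤ B (v + t • φ) (v + t • φ)) : B v φ = 0 := by
  have hd := discrim_le_zero (a := B φ φ) (b := 2 * B v φ) (c := 0) fun t => by
    have := h t
    simp only [map_add, map_smul, LinearMap.add_apply, LinearMap.smul_apply, smul_eq_mul, hv,
      hB φ v] at this
    linarith
  rw [discrim] at hd
  nlinarith [sq_nonneg (B v φ)]

/-- On a nontrivial closed subspace the Rayleigh quotient attains its minimum. -/
theorem exists_rayleigh_minimizer {W : ∀ e, G.Edge e → ℝ} (hW : ∀ e, Integrable (W e)) {M : ℝ}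
    (hM : ∀ e, ∀ᵐ x, |W e x| ≤ M) (K : Submodule ℝ G.H1) (hK : IsClosed (K : Set G.H1))
    (hne : K ≠ ⊥) : ∃ v ∈ K, v ≠ 0 ∧ ∃ μ, (∀ w ∈ K, energy W hW v w = μ * l2 v w) ∧
      ∀ w ∈ K, μ * l2 w w ≤ energy W hW w w := by
  let N : (∀ e, C(G.Edge e, ℝ)) → ℝ := fun f => ∑ e, ∫ x, 1 * (f e * f e) x
  have hN : Continuous N := continuous_finsetSum _ fun e _ =>
    (continuous_integral_weight (integrable_one e)).comp
      ((continuous_apply e).mul (continuous_apply e))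
  have hNl : ∀ u : G.H1, N u.1.1 = l2 u u := fun u => by
    rw [l2_apply]
    exact Finset.sum_congr rfl fun e _ => by simp [H1.val]
  have hN2 : ∀ (s : ℝ) f, N (s • f) = s ^ 2 * N f := fun s f => by
    simp only [N, Finset.mul_sum, ← MeasureTheory.integral_const_mul]
    refine Finset.sum_congr rfl fun e _ => ?_
    congr 1; ext x; simp; ring
  -- Since W ≥ −M, the shift by M + 1 makes the form coercive; it only adds a constant to the
  -- Rayleigh quotient.
  have hco := coercive_of_gap hW hM (μ := -M) (lam := M + 1) (fun u => by
    have h1 := neg_mul_l2_le_mass hW hM u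
    have h2 := dirichlet_self_nonneg u
    rw [energy_apply]; linarith) (by linarith)
  obtain ⟨w, hw, hw0⟩ := (Submodule.ne_bot_iff K).1 hne
  obtain ⟨v, hv, hv1, hmin⟩ := exists_minimizer hco N hN hN2 K hK
    ⟨w, hw, by rw [hNl]; exact l2_self_pos hw0⟩
  rw [hNl] at hv1
  set μ := energy W hW v v with hμ
  have hmin' : ∀ w ∈ K, μ * l2 w w ≤ energy W hW w w := by
    intro w hw
    have := hmin w hw
    rw [hNl, energy_add_const hW, energy_add_const hW, hv1] at this
    linarith
  refine ⟨v, hv, ?_, μ, fun w hw => ?_, hmin'⟩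
  · rintro rfl
    simp at hv1
  · have := LinearMap.BilinForm.eq_zero_of_nonneg_line (B := energy W hW - μ • l2) (v := v) (φ := w)
      (fun a b => by simp [energy_comm hW a b, l2_comm a b]) (by simp [hv1, ← hμ]) (fun t => by
        have := hmin' _ (K.add_mem hv (K.smul_mem t hw))
        rw [LinearMap.sub_apply, LinearMap.sub_apply, LinearMap.smul_apply, LinearMap.smul_apply,
          smul_eq_mul]
        linarith)
    rw [LinearMap.sub_apply, LinearMap.sub_apply, LinearMap.smul_apply, LinearMap.smul_apply,
      smul_eq_mul] at this
    linarith

lemma spectralSpace_mono (W : ∀ e, G.Edge e → ℝ) {s t : ℝ} (h : s ≤ t) :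
    spectralSpace W s ≤ spectralSpace W t :=
  Submodule.span_mono fun _ ⟨μ, hμ, hv⟩ => ⟨μ, hμ.trans h, hv⟩

lemma l2_eq_zero_of_ne {W : ∀ e, G.Edge e → ℝ} (hW : ∀ e, Integrable (W e)) {μ ν : ℝ}
    (h : μ ≠ ν) {u v : G.H1} (hu : IsLinearSolution W μ u) (hv : IsLinearSolution W ν v) :
    l2 u v = 0 := by
  have h1 := (isLinearSolution_iff hW).1 hu v
  have h2 := (isLinearSolution_iff hW).1 hv u
  rw [energy_comm, h1, l2_comm v u] at h2
  by_contra h0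
  exact h (mul_right_cancel₀ h0 h2)

/-- The eigenfunctions with a given eigenvalue. -/
def eigenspace {W : ∀ e, G.Edge e → ℝ} (hW : ∀ e, Integrable (W e)) (μ : ℝ) : Submodule ℝ G.H1 :=
  LinearMap.ker (energy W hW - μ • l2)

lemma mem_eigenspace {W : ∀ e, G.Edge e → ℝ} (hW : ∀ e, Integrable (W e)) {μ : ℝ} {v : G.H1} :
    v ∈ eigenspace hW μ ↔ IsLinearSolution W μ v := by
  rw [isLinearSolution_iff hW, eigenspace, LinearMap.mem_ker, LinearMap.ext_iff]
  simp [sub_eq_zero]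

/-- The quadratic form on the spectral space is bounded by the spectral parameter. -/
theorem energy_le_of_mem_spectralSpace {W : ∀ e, G.Edge e → ℝ} (hW : ∀ e, Integrable (W e)) {t : ℝ}
    {u : G.H1} (hu : u ∈ spectralSpace W t) : energy W hW u u ≤ t * l2 u u := by
  -- Regrouping by eigenvalue leaves one component per eigenvalue, and distinct components are
  -- L²-orthogonal, so both forms become diagonal.
  have hle : spectralSpace W t ≤ ⨆ μ : Set.Iic t, eigenspace hW μ.1 := by
    refine Submodule.span_le.2 ?_
    rintro v ⟨μ, hμ, hv⟩
    exact Submodule.mem_iSup_of_mem (⟨μ, hμ⟩ : Set.Iic t) ((mem_eigenspace hW).2 hv)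
  obtain ⟨f, hf, rfl⟩ := (Submodule.mem_iSup_iff_exists_finsupp _ _).1 (hle hu)
  have hsol := fun μ : Set.Iic t => (mem_eigenspace hW).1 (hf μ)
  rw [Finsupp.sum]
  have hlo : ∀ i ∈ f.support, l2 (f i) (∑ j ∈ f.support, f j) = l2 (f i) (f i) := by
    intro i hi
    rw [map_sum]
    refine Finset.sum_eq_single_of_mem i hi fun j _ hj => ?_
    exact l2_eq_zero_of_ne hW (fun h => hj (Subtype.ext h).symm) (hsol i) (hsol j)
  have h1 : energy W hW (∑ i ∈ f.support, f i) (∑ i ∈ f.support, f i)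
      = ∑ i ∈ f.support, i.1 * l2 (f i) (f i) := by
    conv_lhs => rw [map_sum (energy W hW), LinearMap.sum_apply]
    refine Finset.sum_congr rfl fun i hi => ?_
    rw [(isLinearSolution_iff hW).1 (hsol i), hlo i hi]
  have h2 : l2 (∑ i ∈ f.support, f i) (∑ i ∈ f.support, f i) = ∑ i ∈ f.support, l2 (f i) (f i) := by
    conv_lhs => rw [map_sum l2, LinearMap.sum_apply]
    exact Finset.sum_congr rfl hlo
  rw [h1, h2, Finset.mul_sum]
  exact Finset.sum_le_sum fun i _ => mul_le_mul_of_nonneg_right i.2 (l2_self_nonneg _)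

lemma isClosed_l2_orthogonal (Z : Submodule ℝ G.H1) :
    IsClosed ((LinearMap.BilinForm.orthogonal l2 Z : Submodule ℝ G.H1) : Set G.H1) := by
  have : ((LinearMap.BilinForm.orthogonal l2 Z : Submodule ℝ G.H1) : Set G.H1)
      = ⋂ z ∈ Z, {u | l2 u z = 0} := by
    ext u
    simp [LinearMap.BilinForm.mem_orthogonal_iff, l2_comm u]
  rw [this]
  exact isClosed_biInter fun z _ => isClosed_eq (continuous_mass_left _ z) continuous_const

/-- Definiteness makes Z → Z* injective, hence onto by dimension, so the functional B(φ, ·) on Z is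
represented by some z. No completeness is involved. -/
lemma _root_.LinearMap.BilinForm.exists_sub_mem_orthogonal {M : Type*} [AddCommGroup M]
    [Module ℝ M] {B : LinearMap.BilinForm ℝ M} (hB : ∀ u v, B u v = B v u)
    (hpos : ∀ u, u ≠ 0 → 0 < B u u) (Z : Submodule ℝ M) [FiniteDimensional ℝ Z] (φ : M) :
    ∃ z ∈ Z, φ - z ∈ B.orthogonal Z := by
  let T : Z →ₗ[ℝ] Module.Dual ℝ Z := B.restrict Z
  have hinj : Function.Injective T := by
    rw [← LinearMap.ker_eq_bot, LinearMap.ker_eq_bot']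
    intro z hz
    by_contra h0
    refine (hpos z (fun h' => h0 (Subtype.ext h'))).ne' ?_
    exact LinearMap.congr_fun hz z
  have hsurj := (LinearMap.injective_iff_surjective_of_finrank_eq_finrank
    Subspace.dual_finrank_eq.symm).1 hinj
  obtain ⟨z, hz⟩ := hsurj ((B φ).comp Z.subtype)
  refine ⟨z, z.2, LinearMap.BilinForm.mem_orthogonal_iff.2 fun y hy => ?_⟩
  have : B (z : M) y = B φ y := LinearMap.congr_fun hz ⟨y, hy⟩
  rw [hB, map_sub, LinearMap.sub_apply, this, sub_self]

lemma exists_l2_projection (Z : Submodule ℝ G.H1) [FiniteDimensional ℝ Z] (φ : G.H1) :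
    ∃ z ∈ Z, φ - z ∈ LinearMap.BilinForm.orthogonal l2 Z :=
  LinearMap.BilinForm.exists_sub_mem_orthogonal l2_comm (fun _ => l2_self_pos) Z φ

/-- There are arbitrarily many independent eigenfunctions. -/
theorem exists_le_rank_spectralSpace [Nonempty E] {W : ∀ e, G.Edge e → ℝ}
    (hW : ∀ e, MemLp (W e) ⊤ volume) (k : ℕ) :
    ∃ t, (k : Cardinal) ≤ Module.rank ℝ (spectralSpace W t) := by
  have hWi : ∀ e, Integrable (W e) := fun e => (hW e).integrable le_top
  obtain ⟨M, -, hM⟩ := exists_weight_bound hW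
  induction k with
  | zero => exact ⟨0, by simp⟩
  | succ k ih =>
    obtain ⟨t, ht⟩ := ih
    have hfree := fun s => Module.Free.of_divisionRing ℝ (spectralSpace W s)
    by_cases hfin : Module.Finite ℝ (spectralSpace W t)
    · set Z := spectralSpace W t with hZ
      -- Otherwise projection onto Z would make all of H¹ equal to Z.
      have hK : LinearMap.BilinForm.orthogonal l2 Z ≠ ⊥ := by
        intro h
        have htop : Z = ⊤ := by
          refine Submodule.eq_top_iff'.2 fun φ => ?_
          obtain ⟨z, hz, hφ⟩ := exists_l2_projection Z φ
          rw [h, Submodule.mem_bot, sub_eq_zero] at hφ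
          rwa [hφ]
        rw [htop] at hfin
        exact not_finite_H1 (Module.Finite.equiv (Submodule.topEquiv (R := ℝ) (M := G.H1)))
      obtain ⟨v, hv, hv0, μ, hsol, -⟩ := exists_rayleigh_minimizer hWi hM _
        (isClosed_l2_orthogonal Z) hK
      have hvZ : ∀ z ∈ Z, l2 v z = 0 := fun z hz => by
        rw [l2_comm]; exact LinearMap.BilinForm.mem_orthogonal_iff.1 hv z hz
      -- Being L²-orthogonal to the eigenfunctions that span Z, v is energy-orthogonal to them too.
      -- The equation, known on the orthogonal complement of Z, therefore holds against every test
      -- function.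
      have hvE : ∀ z ∈ Z, energy W hWi v z = 0 := by
        intro z hz
        have hle : Z ≤ LinearMap.ker (energy W hWi v) := by
          refine Submodule.span_le.2 ?_
          rintro z ⟨ν, hν, hz⟩
          rw [SetLike.mem_coe, LinearMap.mem_ker, energy_comm, (isLinearSolution_iff hWi).1 hz,
            l2_comm, hvZ z (Submodule.subset_span ⟨ν, hν, hz⟩), mul_zero]
        exact hle hz
      have hvsol : IsLinearSolution W μ v := by
        rw [isLinearSolution_iff hWi]
        intro φ
        obtain ⟨z, hz, hw⟩ := exists_l2_projection Z φ
        have h1 := hsol _ hw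
        rwa [map_sub, map_sub, hvE z hz, hvZ z hz, sub_zero, sub_zero] at h1
      have hvn : v ∉ Z := fun h => (l2_self_pos hv0).ne' (hvZ v h)
      refine ⟨max t μ, ?_⟩
      have hlt : Z < spectralSpace W (max t μ) := by
        refine lt_of_le_of_ne (spectralSpace_mono W (le_max_left _ _)) fun h => hvn ?_
        rw [h]
        exact Submodule.subset_span ⟨μ, le_max_right _ _, hvsol⟩
      by_cases hfin' : Module.Finite ℝ (spectralSpace W (max t μ))
      · have h1 := Submodule.finrank_lt_finrank_of_lt hlt
        rw [← Module.finrank_eq_rank] at ht ⊢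
        have := Nat.cast_le.1 ht
        exact Nat.cast_le.2 (by omega)
      · rw [← Module.rank_lt_aleph0_iff, not_lt] at hfin'
        exact (Cardinal.natCast_lt_aleph0 (n := k + 1)).le.trans hfin'
    · rw [← Module.rank_lt_aleph0_iff, not_lt] at hfin
      exact ⟨t, (Cardinal.natCast_lt_aleph0 (n := k + 1)).le.trans hfin⟩

/-- The first eigenvalue is the minimum of the Rayleigh quotient, and it is attained. -/
theorem first_eigenvalue [Nonempty E] {W : ∀ e, G.Edge e → ℝ} (hW : ∀ e, MemLp (W e) ⊤ volume)
    (hWi : ∀ e, Integrable (W e)) :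
    (∀ u : G.H1, eigenvalue W 1 * l2 u u ≤ energy W hWi u u) ∧
      ∃ v : G.H1, v ≠ 0 ∧ energy W hWi v v = eigenvalue W 1 * l2 v v := by
  obtain ⟨M, -, hM⟩ := exists_weight_bound hW
  have htop : (⊤ : Submodule ℝ G.H1) ≠ ⊥ := by
    intro h
    refine not_finite_H1 (G := G) ?_
    exact Module.finite_def.2 (h ▸ Submodule.fg_bot)
  obtain ⟨v, -, hv0, μ, hsol, hmin⟩ := exists_rayleigh_minimizer hWi hM ⊤ isClosed_univ htop
  -- A nonzero element of the spectral space at level t has Rayleigh quotient at most t, and no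
  -- quotient is below μ.
  have hset : {t | ((1 : ℕ) : Cardinal) ≤ Module.rank ℝ (spectralSpace W t)} = Set.Ici μ := by
    ext t
    rw [Set.mem_ofPred_eq, Set.mem_Ici, Nat.cast_one, Cardinal.one_le_iff_ne_zero]
    constructor
    · intro h
      obtain ⟨u, hu, hu0⟩ := (Submodule.ne_bot_iff (spectralSpace W t)).1 fun hb => h (by
        rw [hb]; exact rank_bot ℝ G.H1)
      exact le_of_mul_le_mul_right ((hmin u trivial).trans (energy_le_of_mem_spectralSpace hWi hu))
        (l2_self_pos hu0)
    · intro h h0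
      have hb : spectralSpace W t = ⊥ := Submodule.rank_eq_zero.1 h0
      have hv : v ∈ spectralSpace W t :=
        Submodule.subset_span ⟨μ, h, (isLinearSolution_iff hWi).2 fun φ => hsol φ trivial⟩
      rw [hb, Submodule.mem_bot] at hv
      exact hv0 hv
  have hμ : eigenvalue W 1 = μ := by rw [eigenvalue, hset, csInf_Ici]
  rw [hμ]
  exact ⟨fun u => hmin u trivial, v, hv0, hsol v trivial⟩

end CompactMetricGraph

end

/-! ### Positive first eigenfunction and lower bounds for the Morse index -/

noncomputable section

open MeasureTheory Filter Topology

namespace CompactMetricGraph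

variable {V E : Type*} {G : CompactMetricGraph V E}

lemma nlWeight_nonneg {p : ℝ} {ρ : ∀ e, G.Edge e → ℝ} (hρ0 : ∀ e, ∀ᵐ x, 0 ≤ ρ e x) (u : G.H1)
    (e : E) : ∀ᵐ x, 0 ≤ nlWeight p ρ u e x := by
  filter_upwards [hρ0 e] with x hx
  exact mul_nonneg hx (Real.rpow_nonneg (abs_nonneg _) _)

variable [Fintype E]

/-- Passing from v to |v| keeps the zero-order terms and does not increase ∫ v'², so |v| is again a
Rayleigh minimiser, hence an eigenfunction. -/
lemma exists_nonneg_eigenfunction [Nonempty E] {W : ∀ e, G.Edge e → ℝ}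
    (hW : ∀ e, MemLp (W e) ⊤ volume) (hWi : ∀ e, Integrable (W e)) :
    ∃ w : G.H1, w ≠ 0 ∧ (∀ e x, 0 ≤ H1.val w e x) ∧
      ∀ φ, energy W hWi w φ = eigenvalue W 1 * l2 w φ := by
  obtain ⟨hmin, v, hv0, hv⟩ := first_eigenvalue hW hWi
  obtain ⟨w, hw, hwd, -⟩ := exists_comp v (F := fun y => |y|) (s := Set.univ) (K := 1)
    (fun _ _ => trivial) (LipschitzWith.of_dist_le_mul fun x y => by
      simpa [Real.dist_eq] using abs_abs_sub_abs_le x y).lipschitzOnWith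
  have hl : l2 w w = l2 v v := by simp only [l2_apply, hw, abs_mul_abs_self]
  have hm : mass W hWi w w = mass W hWi v v := by
    simp only [mass_apply, hw, mul_assoc, abs_mul_abs_self]
  have hd : dirichlet w w ≤ dirichlet v v := by
    rw [dirichlet_eq_integral, dirichlet_eq_integral]
    refine integral_mono (integrable_der_mul w w) (integrable_der_mul v v) fun e => ?_
    filter_upwards [hwd e] with x hx
    rw [NNReal.coe_one, one_mul] at hx
    exact abs_le_iff_mul_self_le.1 hx
  have hB : energy W hWi w w = eigenvalue W 1 * l2 w w := by
    refine le_antisymm ?_ (hmin w)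
    rw [hl, ← hv, energy_apply, energy_apply, hm]
    linarith
  refine ⟨w, ?_, fun e x => by rw [hw]; exact abs_nonneg _, fun φ => ?_⟩
  · rintro rfl
    rw [map_zero] at hl
    exact (l2_self_pos hv0).ne hl
  · have := LinearMap.BilinForm.eq_zero_of_nonneg_line
      (B := energy W hWi - eigenvalue W 1 • l2) (v := w) (φ := φ)
      (fun a b => by simp [energy_comm hWi a b, l2_comm a b]) (by simp [hB]) (fun t => by
        have := hmin (w + t • φ)
        rw [LinearMap.sub_apply, LinearMap.sub_apply, LinearMap.smul_apply, LinearMap.smul_apply,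
          smul_eq_mul]
        linarith)
    rw [LinearMap.sub_apply, LinearMap.sub_apply, LinearMap.smul_apply, LinearMap.smul_apply,
      smul_eq_mul] at this
    linarith

/-- The shift by ε keeps log(w+ε), and likewise 1/(w+ε), a Lipschitz function of w ≥ 0, so that
`exists_comp` applies. -/
lemma _root_.lipschitzOnWith_log_add {ε : ℝ} (hε : 0 < ε) :
    LipschitzOnWith (Real.toNNReal ε⁻¹) (fun y => Real.log (y + ε)) (Set.Ici 0) := by
  refine (convex_Ici (0 : ℝ)).lipschitzOnWith_of_nnnorm_hasDerivWithin_le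
    (f' := fun y => (y + ε)⁻¹) (fun y hy => ?_) (fun y hy => ?_)
  · have h : HasDerivAt (fun y : ℝ => Real.log (y + ε)) _ y :=
      ((hasDerivAt_id y).add_const ε).log (by have : 0 ≤ y := hy; simp; positivity)
    simpa using h.hasDerivWithinAt
  · have hy' : 0 ≤ y := hy
    rw [← NNReal.coe_le_coe, coe_nnnorm, Real.coe_toNNReal _ (by positivity),
      Real.norm_of_nonneg (by positivity)]
    gcongr
    linarith

lemma _root_.lipschitzOnWith_inv_add {ε : ℝ} (hε : 0 < ε) :
    LipschitzOnWith (Real.toNNReal (ε ^ 2)⁻¹) (fun y => (y + ε)⁻¹) (Set.Ici 0) := by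
  refine (convex_Ici (0 : ℝ)).lipschitzOnWith_of_nnnorm_hasDerivWithin_le
    (f' := fun y => -1 / (y + ε) ^ 2) (fun y hy => ?_) (fun y hy => ?_)
  · have hy' : 0 ≤ y := hy
    exact (((hasDerivAt_id y).add_const ε).fun_inv
      (by simp; positivity)).hasDerivWithinAt
  · have hy' : 0 ≤ y := hy
    rw [← NNReal.coe_le_coe, coe_nnnorm, Real.coe_toNNReal _ (by positivity), norm_div,
      Real.norm_of_nonneg (by positivity : 0 ≤ (y + ε) ^ 2), norm_neg, norm_one, one_div]
    gcongr
    linarith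

/-- The logarithmic derivative of a nonnegative solution is bounded in `L²`. -/
lemma exists_log_comp {W : ∀ e, G.Edge e → ℝ} (hW : ∀ e, Integrable (W e)) {μ : ℝ} {w : G.H1}
    (hw : ∀ e x, 0 ≤ H1.val w e x) (hsol : ∀ φ, energy W hW w φ = μ * l2 w φ) {ε : ℝ}
    (hε : 0 < ε) : ∃ ψ : G.H1, (∀ e x, H1.val ψ e x = Real.log (H1.val w e x + ε)) ∧
      dirichlet ψ ψ ≤ integral fun e x => |W e x + -μ| := by
  obtain ⟨ψ, hψ, -, hψd⟩ := exists_comp w (s := Set.Ici 0) hw (lipschitzOnWith_log_add hε)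
  -- The test function η = 1/(w+ε) satisfies w'η' = −(ψ')², and 0 ≤ wη ≤ 1 bounds the remaining term
  -- independently of ε.
  obtain ⟨η, hη, -, hηd⟩ := exists_comp w (s := Set.Ici 0) hw (lipschitzOnWith_inv_add hε)
  refine ⟨ψ, hψ, ?_⟩
  have h1 := hψd (fun y => (y + ε)⁻¹) fun y hy => by
    have hy' : 0 ≤ y := hy
    have h : HasDerivAt (fun y : ℝ => Real.log (y + ε)) _ y :=
      ((hasDerivAt_id y).add_const ε).log (by simp; positivity)
    simpa using h
  have h2 := hηd (fun y => -1 / (y + ε) ^ 2) fun y hy => by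
    have hy' : 0 ≤ y := hy
    exact ((hasDerivAt_id y).add_const ε).fun_inv (by simp; positivity)
  have hd : dirichlet w η = - dirichlet ψ ψ := by
    rw [dirichlet_eq_integral, dirichlet_eq_integral, ← neg_one_mul, ← integral_const_mul]
    refine integral_congr fun e => ?_
    filter_upwards [h1 e, h2 e] with x hx1 hx2
    rw [hx1, hx2]
    have : H1.val w e x + ε ≠ 0 := by have := hw e x; positivity
    field_simp
  have h3 := hsol η
  rw [energy_apply, hd] at h3
  have h4 : dirichlet ψ ψ = mass (fun e x => W e x + -μ) (integrable_weight_add_const hW (-μ)) w η := by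
    rw [mass_add_const hW]; linarith
  rw [h4, mass_apply]
  refine integral_mono (integrable_mass (integrable_weight_add_const hW (-μ)) w η)
    (fun e => (integrable_weight_add_const hW (-μ) e).abs) fun e => ?_
  refine Eventually.of_forall fun x => ?_
  have h0 := hw e x
  simp only
  rw [hη, mul_assoc]
  have hq : 0 ≤ H1.val w e x * (H1.val w e x + ε)⁻¹ ∧ H1.val w e x * (H1.val w e x + ε)⁻¹ ≤ 1 := by
    refine ⟨by positivity, ?_⟩
    rw [← div_eq_mul_inv, div_le_one (by positivity)]
    linarith
  calc (W e x + -μ) * (H1.val w e x * (H1.val w e x + ε)⁻¹)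
      ≤ |W e x + -μ| * (H1.val w e x * (H1.val w e x + ε)⁻¹) :=
        mul_le_mul_of_nonneg_right (le_abs_self _) hq.1
    _ ≤ |W e x + -μ| := mul_le_of_le_one_right (abs_nonneg _) hq.2

/-- A nonnegative solution with a zero on an edge vanishes on that edge. -/
lemma val_eq_zero_on_edge {W : ∀ e, G.Edge e → ℝ} (hW : ∀ e, Integrable (W e)) {μ : ℝ} {w : G.H1}
    (hw : ∀ e x, 0 ≤ H1.val w e x) (hsol : ∀ φ, energy W hW w φ = μ * l2 w φ) {e : E}
    {x₀ : G.Edge e} (h0 : H1.val w e x₀ = 0) (x : G.Edge e) : H1.val w e x = 0 := by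
  set C := integral fun e x => |W e x + -μ|
  set R := √C * √(G.length e) with hR
  -- R bounds the oscillation of log(w+ε) on the edge for every ε. Its value at x₀ is log ε, hence
  -- w(x) + ε ≤ ε·exp R; let ε → 0.
  have key : ∀ ε > 0, H1.val w e x ≤ ε * Real.exp R := by
    intro ε hε
    obtain ⟨ψ, hψ, hC⟩ := exists_log_comp hW hw hsol hε
    have h1 := (ψ.2.1 e).abs_sub_le x x₀
    have h2 : |ψ.1.1 e x - ψ.1.1 e x₀| ≤ R := by
      refine h1.trans ?_
      have h3 : |(x : ℝ) - x₀| ≤ G.length e := by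
        rw [abs_le]; constructor <;> linarith [x.2.1, x.2.2, x₀.2.1, x₀.2.2]
      have h4 : ‖ψ.1.2 e‖ ≤ √C := Real.le_sqrt_of_sq_le ((norm_der_sq_le ψ e).trans hC)
      rw [hR]
      gcongr
    have h5 : H1.val ψ e x - H1.val ψ e x₀ ≤ R := (le_abs_self _).trans h2
    rw [hψ, hψ, h0, zero_add] at h5
    have hpos : 0 < H1.val w e x + ε := by have := hw e x; positivity
    have h6 : H1.val w e x + ε ≤ ε * Real.exp R := by
      rw [← Real.log_le_log_iff hpos (by positivity), Real.log_mul hε.ne' (Real.exp_ne_zero _),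
        Real.log_exp]
      linarith
    linarith
  refine le_antisymm (le_of_forall_pos_le_add fun δ hδ => ?_) (hw e x)
  have := key (δ / Real.exp R) (by positivity)
  rw [div_mul_cancel₀ _ (Real.exp_ne_zero _)] at this
  linarith

/-- The first eigenvalue has a positive eigenfunction. -/
theorem exists_pos_eigenfunction [Nonempty E] {W : ∀ e, G.Edge e → ℝ}
    (hW : ∀ e, MemLp (W e) ⊤ volume) (hWi : ∀ e, Integrable (W e)) :
    ∃ w : G.H1, (∀ e x, 0 < H1.val w e x) ∧
      ∀ φ, energy W hWi w φ = eigenvalue W 1 * l2 w φ := by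
  obtain ⟨w, hw0, hw, hsol⟩ := exists_nonneg_eigenfunction hW hWi
  refine ⟨w, fun e x => lt_of_le_of_ne (hw e x) fun h => hw0 ?_, hsol⟩
  obtain ⟨c, hc⟩ := w.2.2
  have hl : ∀ e, H1.val w e (G.left e) = c (G.src e) := fun e => (hc e).1
  have hr : ∀ e, H1.val w e (G.right e) = c (G.tgt e) := fun e => (hc e).2
  have hz : ∀ {e : E} {x : G.Edge e}, H1.val w e x = 0 → ∀ y, H1.val w e y = 0 :=
    fun h => val_eq_zero_on_edge hWi hw hsol h
  -- A zero at one end of an edge forces a zero at the other, so zeros spread over the connected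
  -- graph.
  have hprop : ∀ a b, Relation.EqvGen (fun a b => ∃ e, G.src e = a ∧ G.tgt e = b) a b →
      (c a = 0 ↔ c b = 0) := by
    intro a b hab
    induction hab with
    | rel a b h =>
      obtain ⟨e, rfl, rfl⟩ := h
      rw [← hl, ← hr]
      exact ⟨fun h => hz h _, fun h => hz h _⟩
    | refl a => rfl
    | symm a b _ ih => exact ih.symm
    | trans a b d _ _ ih1 ih2 => exact ih1.trans ih2
  have h0 : c (G.src e) = 0 := by rw [← hl]; exact hz h.symm _
  refine H1.eq_zero_of_val fun e' y => hz (x := G.left e') ?_ y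
  rw [hl]
  exact (hprop _ _ (G.connected _ _)).1 h0

/-- Linear independence comes for free: the form vanishes at 0, so no nontrivial combination can be
0. -/
lemma le_morseIndex {p : ℝ} (hp : 2 < p) {W ρ : ∀ e, G.Edge e → ℝ} (hW : ∀ e, Integrable (W e))
    (hρ : ∀ e, Integrable (ρ e)) {lam : ℝ} {u : G.H1} {k : ℕ} (f : Fin k → G.H1)
    (hf : ∀ a : Fin k → ℝ, a ≠ 0 → quadForm p W ρ lam u (∑ i, a i • f i) < 0) :
    (k : ℕ∞) ≤ morseIndex p W ρ lam u := by
  have hq0 : quadForm p W ρ lam u 0 = 0 := by simp [quadForm_eq hp hW hρ]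
  have hli : LinearIndependent ℝ f := by
    rw [Fintype.linearIndependent_iff]
    intro a ha
    by_contra! h
    have := hf a fun h0 => by obtain ⟨i, hi⟩ := h; exact hi (congrFun h0 i)
    rw [ha, hq0] at this
    exact lt_irrefl _ this
  refine le_sSup ⟨k, Submodule.span ℝ (Set.range f), rfl, ?_, fun φ hφ h0 => ?_⟩
  · rw [rank_span hli]
    simpa using Cardinal.mk_range_eq_of_injective hli.injective
  · obtain ⟨a, rfl⟩ := (Submodule.mem_span_range_iff_exists_fun ℝ).1 hφ
    exact hf a fun h => h0 (by simp [h])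

/-- One common point of nonvanishing suffices by continuity. For a second function without zeros,
any point where u ≠ 0 will do. -/
lemma mass_nlWeight_pos {p : ℝ} (hp : 2 < p) {ρ : ∀ e, G.Edge e → ℝ} (hρ : ∀ e, Integrable (ρ e))
    {b : ℝ} (hb : 0 < b) (hρb : ∀ e, ∀ᵐ x, b ≤ ρ e x) {u v : G.H1} {e₀ : E} {x₀ : G.Edge e₀}
    (hu : H1.val u e₀ x₀ ≠ 0) (hv : H1.val v e₀ x₀ ≠ 0) :
    0 < mass (nlWeight p ρ u) (integrable_nlWeight hp hρ u) v v := by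
  have := integral_pos_of_weight hρ hb hρb (fun e => ⟨fun x => |H1.val u e x| ^ (p - 2) *
    (H1.val v e x * H1.val v e x), ((continuous_val u e).abs.rpow_const fun _ =>
      Or.inr (by linarith)).mul ((continuous_val v e).mul (continuous_val v e))⟩)
    (fun e x => mul_nonneg (Real.rpow_nonneg (abs_nonneg _) _) (mul_self_nonneg _))
    (e₀ := e₀) (x₀ := x₀)
    (mul_ne_zero (Real.rpow_pos_of_pos (abs_pos.2 hu) _).ne' (mul_self_ne_zero.2 hv))
  rw [mass_apply]
  simpa [nlWeight, mul_assoc] using this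

lemma _root_.Submodule.exists_fin_of_le_rank {M : Type*} [AddCommGroup M] [Module ℝ M]
    {Z : Submodule ℝ M} {k : ℕ} (h : (k : Cardinal) ≤ Module.rank ℝ Z) :
    ∃ f : Fin k → M, (∀ i, f i ∈ Z) ∧ ∀ a : Fin k → ℝ, a ≠ 0 → ∑ i, a i • f i ≠ 0 := by
  obtain ⟨f, hf⟩ := Module.le_rank_iff.1 h
  have hli := hf.map' Z.subtype (Submodule.ker_subtype _)
  exact ⟨fun i => f i, fun i => (f i).2, fun a ha h0 =>
    ha (funext (Fintype.linearIndependent_iff.1 hli a h0))⟩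

/-- Below `-λ_k`, every function has Morse index at least `k`. -/
theorem le_morseIndex_of_lt_neg_eigenvalue [Nonempty E] {p : ℝ} (hp : 2 < p)
    {W ρ : ∀ e, G.Edge e → ℝ} (hW : ∀ e, MemLp (W e) ⊤ volume) (hρ : ∀ e, Integrable (ρ e))
    (hρ0 : ∀ e, ∀ᵐ x, 0 ≤ ρ e x) {k : ℕ} {lam : ℝ} (h : lam < -eigenvalue W k) (u : G.H1) :
    (k : ℕ∞) ≤ morseIndex p W ρ lam u := by
  have hWi : ∀ e, Integrable (W e) := fun e => (hW e).integrable le_top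
  -- The infimum defining the eigenvalue runs over a nonempty set, so a level t strictly below −λ
  -- carries k independent vectors.
  obtain ⟨t, ht, htl⟩ := exists_lt_of_csInf_lt (exists_le_rank_spectralSpace hW k)
    (show sInf {t | (k : Cardinal) ≤ Module.rank ℝ (spectralSpace W t)} < -lam by
      have : eigenvalue W k < -lam := by linarith
      exact this)
  obtain ⟨f, hfZ, hf⟩ := Submodule.exists_fin_of_le_rank ht
  refine le_morseIndex hp hWi hρ f fun a ha => ?_
  have hz0 := hf a ha
  have hz := Submodule.sum_mem _ fun i (_ : i ∈ Finset.univ) => Submodule.smul_mem _ (a i) (hfZ i)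
  generalize ∑ i, a i • f i = z at hz hz0
  have h1 := energy_le_of_mem_spectralSpace hWi hz
  have h2 := l2_self_pos hz0
  have h3 := mass_self_nonneg (integrable_nlWeight hp hρ u) (nlWeight_nonneg hρ0 u) z
  rw [quadForm_eq hp hWi hρ]
  have h4 : (t + lam) * l2 z z < 0 := mul_neg_of_neg_of_pos (by linarith) h2
  have h5 := mul_nonneg (by linarith : 0 ≤ p - 1) h3
  linarith

/-- Here x₁, x₂ are the energies of (u,u), (u,φ); x₄, x₅, x₃ the L² products of (u,u), (u,φ), (φ,φ);
and y₁, y₂, y₃ the products with weight ρ|u|^(p−2). The equations e₁, e₂ reduce the form to −(p−2)P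
− b²y₃ + b²(μ+λ)x₃. For b ≠ 0 the middle term is negative; for b = 0 it is P = a²y₁ > 0 that
decides. -/
lemma neg_of_pencil {p lam μ a b x₁ x₂ x₃ x₄ x₅ y₁ y₂ y₃ : ℝ} (hp : 2 < p)
    (hab : ¬ (a = 0 ∧ b = 0)) (e₁ : x₁ + lam * x₄ = y₁) (e₂ : x₂ + lam * x₅ = y₂) (h₁ : 0 < y₁)
    (h₃ : 0 < y₃) (hP : 0 ≤ a * (a * y₁ + b * y₂) + b * (a * y₂ + b * y₃))
    (hC : (μ + lam) * x₃ ≤ 0) :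
    a * (a * x₁ + b * x₂) + b * (a * x₂ + b * (μ * x₃))
      + lam * (a * (a * x₄ + b * x₅) + b * (a * x₅ + b * x₃))
      - (p - 1) * (a * (a * y₁ + b * y₂) + b * (a * y₂ + b * y₃)) < 0 := by
  set P := a * (a * y₁ + b * y₂) + b * (a * y₂ + b * y₃) with hPdef
  have hQ : a * (a * x₁ + b * x₂) + b * (a * x₂ + b * (μ * x₃))
      + lam * (a * (a * x₄ + b * x₅) + b * (a * x₅ + b * x₃)) - (p - 1) * P
      = -((p - 2) * P) - b ^ 2 * y₃ + b ^ 2 * ((μ + lam) * x₃) := by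
    rw [hPdef, ← e₁, ← e₂]; ring
  rw [hQ]
  have h4 := mul_nonpos_of_nonneg_of_nonpos (sq_nonneg b) hC
  by_cases hb : b = 0
  · have ha : a ≠ 0 := fun ha => hab ⟨ha, hb⟩
    have hPpos : 0 < P := by
      have : P = a ^ 2 * y₁ := by rw [hPdef, hb]; ring
      rw [this]; positivity
    have := mul_pos (by linarith : 0 < p - 2) hPpos
    have h5 : 0 ≤ b ^ 2 * y₃ := by positivity
    linarith
  · have h2 : 0 < b ^ 2 * y₃ := by positivity
    have h3 := mul_nonneg (by linarith : 0 ≤ p - 2) hP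
    linarith

/-- At and below `-λ_1`, every nonzero solution has Morse index at least two. -/
theorem two_le_morseIndex_of_le_neg_eigenvalue [Nonempty E] {p : ℝ} (hp : 2 < p)
    {W ρ : ∀ e, G.Edge e → ℝ} (hW : ∀ e, MemLp (W e) ⊤ volume) (hρ : ∀ e, Integrable (ρ e))
    {b : ℝ} (hb : 0 < b) (hρb : ∀ e, ∀ᵐ x, b ≤ ρ e x) {lam : ℝ} (h : lam ≤ -eigenvalue W 1)
    {u : G.H1} (hu : u ≠ 0) (hsol : IsSolution p W ρ lam u) :
    2 ≤ morseIndex p W ρ lam u := by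
  have hWi : ∀ e, Integrable (W e) := fun e => (hW e).integrable le_top
  have hρ0 : ∀ e, ∀ᵐ x, 0 ≤ ρ e x := fun e => (hρb e).mono fun x hx => hb.le.trans hx
  obtain ⟨φ, hφ, hφs⟩ := exists_pos_eigenfunction hW hWi
  obtain ⟨e₀, x₀, hx₀⟩ := exists_val_ne_zero hu
  have hA := mass_nlWeight_pos hp hρ hb hρb hx₀ hx₀
  have hD := mass_nlWeight_pos hp hρ hb hρb hx₀ (hφ e₀ x₀).ne'
  rw [isSolution_iff hp hWi hρ] at hsol
  refine le_morseIndex (k := 2) hp hWi hρ ![u, φ] fun a ha => ?_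
  have hP := mass_self_nonneg (integrable_nlWeight hp hρ u) (nlWeight_nonneg hρ0 u)
    (a 0 • u + a 1 • φ)
  rw [quadForm_eq hp hWi hρ, Fin.sum_univ_two]
  simp only [Matrix.cons_val_zero, Matrix.cons_val_one]
  simp only [map_add, map_smul, LinearMap.add_apply, LinearMap.smul_apply, smul_eq_mul] at hP ⊢
  rw [mass_comm (integrable_nlWeight hp hρ u) φ u] at hP ⊢
  rw [energy_comm hWi φ u, l2_comm φ u, hφs φ]
  refine neg_of_pencil hp (fun h => ha (funext fun i => ?_)) (hsol u) (hsol φ) hA hD hP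
    (mul_nonpos_of_nonpos_of_nonneg (by linarith : eigenvalue W 1 + lam ≤ 0) (l2_self_nonneg φ))
  fin_cases i
  · exact h.1
  · exact h.2

end CompactMetricGraph

end

/-! ### Second order expansion and ground states -/

noncomputable section

open MeasureTheory Filter Topology

namespace CompactMetricGraph

/-- Away from 0 this is the power rule; at 0 the difference quotient is |y|^q, which tends to 0. It
supplies the second derivative of |x|^p. -/
lemma _root_.hasDerivAt_abs_rpow_mul_self {q : ℝ} (hq : 0 < q) (x : ℝ) :
    HasDerivAt (fun y : ℝ => |y| ^ q * y) ((q + 1) * |x| ^ q) x := by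
  have hcont : Continuous fun y : ℝ => |y| ^ q := continuous_abs.rpow_const fun _ => Or.inr hq.le
  rcases lt_trichotomy x 0 with hx | rfl | hx
  · have h := ((hasDerivAt_neg x).rpow_const (p := q) (Or.inl (by simpa using hx.ne))).mul
      (hasDerivAt_id x)
    have h2 := h.congr_of_eventuallyEq (f₁ := fun y : ℝ => |y| ^ q * y) (by
      filter_upwards [Iio_mem_nhds hx] with y hy
      have : y < 0 := hy
      simp [abs_of_neg this])
    refine h2.congr_deriv ?_
    have h3 : (-x) ^ q = (-x) ^ (q - 1) * (-x) := by
      rw [← Real.rpow_add_one (by linarith)]; ring_nf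
    rw [abs_of_neg hx]
    simp only [id, mul_one]
    rw [h3]; ring
  · rw [abs_zero, Real.zero_rpow hq.ne', mul_zero, hasDerivAt_iff_tendsto_slope]
    have h0 := (hcont.tendsto 0).mono_left (nhdsWithin_le_nhds (s := {0}ᶜ))
    rw [abs_zero, Real.zero_rpow hq.ne'] at h0
    refine h0.congr' ?_
    filter_upwards [self_mem_nhdsWithin] with y hy
    have : y ≠ 0 := hy
    simp [slope_def_field, this]
  · have h := ((hasDerivAt_id x).rpow_const (p := q) (Or.inl hx.ne')).mul (hasDerivAt_id x)
    have h2 := h.congr_of_eventuallyEq (f₁ := fun y : ℝ => |y| ^ q * y) (by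
      filter_upwards [Ioi_mem_nhds hx] with y hy
      have : 0 < y := hy
      simp [abs_of_pos this])
    refine h2.congr_deriv ?_
    have h3 : x ^ q = x ^ (q - 1) * x := by
      rw [← Real.rpow_add_one hx.ne']; ring_nf
    rw [abs_of_pos hx]
    simp only [id, mul_one, one_mul]
    rw [h3]; ring

/-- The derivative increases through 0 at the origin, so g has its minimum over [−δ, δ] there. -/
lemma _root_.nonneg_of_second_deriv_nonneg {g g' g'' : ℝ → ℝ} (hg : ∀ x, HasDerivAt g (g' x) x)
    (hg' : ∀ x, HasDerivAt g' (g'' x) x) {δ : ℝ} (hpos : ∀ x, |x| ≤ δ → 0 ≤ g'' x)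
    (h0 : g 0 = 0) (h0' : g' 0 = 0) {h : ℝ} (hh : |h| ≤ δ) : 0 ≤ g h := by
  have hδ : 0 ≤ δ := (abs_nonneg h).trans hh
  have hmono : MonotoneOn g' (Set.Icc (-δ) δ) := by
    refine monotoneOn_of_deriv_nonneg (convex_Icc _ _)
      (fun x _ => (hg' x).continuousAt.continuousWithinAt)
      (fun x _ => (hg' x).differentiableAt.differentiableWithinAt) fun x hx => ?_
    rw [(hg' x).deriv]
    have hx' := interior_subset hx
    exact hpos x (abs_le.2 hx')
  have hz : (0 : ℝ) ∈ Set.Icc (-δ) δ := ⟨by linarith, hδ⟩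
  rw [abs_le] at hh
  rcases le_total 0 h with hs | hs
  · have : MonotoneOn g (Set.Icc 0 δ) := by
      refine monotoneOn_of_deriv_nonneg (convex_Icc _ _)
        (fun x _ => (hg x).continuousAt.continuousWithinAt)
        (fun x _ => (hg x).differentiableAt.differentiableWithinAt) fun x hx => ?_
      have hx' := interior_subset hx
      rw [(hg x).deriv, ← h0']
      exact hmono hz ⟨by linarith [hx'.1], hx'.2⟩ hx'.1
    rw [← h0]
    exact this ⟨le_rfl, hδ⟩ ⟨hs, hh.2⟩ hs
  · have : AntitoneOn g (Set.Icc (-δ) 0) := by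
      refine antitoneOn_of_deriv_nonpos (convex_Icc _ _)
        (fun x _ => (hg x).continuousAt.continuousWithinAt)
        (fun x _ => (hg x).differentiableAt.differentiableWithinAt) fun x hx => ?_
      have hx' := interior_subset hx
      rw [(hg x).deriv, ← h0']
      exact hmono ⟨hx'.1, by linarith [hx'.2]⟩ hz hx'.2
    rw [← h0]
    exact this ⟨hh.1, hs⟩ ⟨by linarith, le_rfl⟩ hs

/-- A locally uniform lower second order expansion of `|x|^p`. -/
lemma _root_.exists_abs_rpow_lower_expansion {p : ℝ} (hp : 2 < p) (M : ℝ) {ε : ℝ} (hε : 0 < ε) :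
    ∃ δ > 0, ∀ a h : ℝ, |a| ≤ M → |h| ≤ δ →
      |a| ^ p + p * (|a| ^ (p - 2) * a) * h + h ^ 2 / 2 * (p * (p - 1) * |a| ^ (p - 2) - ε)
        ≤ |a + h| ^ p := by
  have hq : 0 < p - 2 := by linarith
  have hcont : Continuous fun y : ℝ => p * (p - 1) * |y| ^ (p - 2) :=
    continuous_const.mul (continuous_abs.rpow_const fun _ => Or.inr hq.le)
  have huc := (isCompact_Icc (a := -(M + 1)) (b := M + 1)).uniformContinuousOn_of_continuous
    hcont.continuousOn
  obtain ⟨δ, hδ, H⟩ := Metric.uniformContinuousOn_iff.1 huc ε hε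
  -- The bound 1 keeps a + h in the compact interval, and δ/2 gives the strict inequality required
  -- by uniform continuity.
  refine ⟨min (δ / 2) 1, by positivity, fun a h ha hh => ?_⟩
  have key := nonneg_of_second_deriv_nonneg
    (g := fun h => |a + h| ^ p - |a| ^ p - p * (|a| ^ (p - 2) * a) * h
      - h ^ 2 / 2 * (p * (p - 1) * |a| ^ (p - 2) - ε))
    (g' := fun h => p * (|a + h| ^ (p - 2) * (a + h)) - p * (|a| ^ (p - 2) * a)
      - h * (p * (p - 1) * |a| ^ (p - 2) - ε))
    (g'' := fun h => p * (p - 1) * |a + h| ^ (p - 2) - (p * (p - 1) * |a| ^ (p - 2) - ε))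
    (δ := min (δ / 2) 1) (fun x => ?_) (fun x => ?_) (fun x hx => ?_) (by simp) (by simp) hh
  · linarith
  · have h1 : HasDerivAt (fun x => |a + x| ^ p) (p * |a + x| ^ (p - 2) * (a + x)) x :=
      (hasDerivAt_abs_rpow (a + x) (by linarith)).comp_const_add a x
    have h2 := ((h1.sub_const (|a| ^ p)).sub
      ((hasDerivAt_id x).const_mul (p * (|a| ^ (p - 2) * a)))).sub
      ((((hasDerivAt_id x).pow 2).div_const 2).mul_const (p * (p - 1) * |a| ^ (p - 2) - ε))
    refine h2.congr_deriv ?_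
    simp; ring
  · have h1 : HasDerivAt (fun x => |a + x| ^ (p - 2) * (a + x))
        ((p - 2 + 1) * |a + x| ^ (p - 2)) x :=
      (hasDerivAt_abs_rpow_mul_self hq (a + x)).comp_const_add a x
    have h2 := ((h1.const_mul p).sub_const (p * (|a| ^ (p - 2) * a))).sub
      ((hasDerivAt_id x).mul_const (p * (p - 1) * |a| ^ (p - 2) - ε))
    refine h2.congr_deriv ?_
    ring
  · have hx1 : |x| ≤ δ / 2 := hx.trans (min_le_left _ _)
    have hx2 : |x| ≤ 1 := hx.trans (min_le_right _ _)
    have hax : |a + x| ≤ M + 1 := (abs_add_le a x).trans (by linarith)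
    have := H (a + x) (abs_le.1 hax) a (abs_le.1 (by linarith)) (by
      rw [Real.dist_eq, add_sub_cancel_left]; linarith)
    rw [Real.dist_eq, abs_lt] at this
    linarith [this.1]

/-- X embeds in the line through f. Applied to a negative subspace and a functional on whose kernel
the form is nonnegative, it bounds the Morse index by 1. -/
lemma _root_.Submodule.rank_le_one_of_ker {M : Type*} [AddCommGroup M] [Module ℝ M]
    {X : Submodule ℝ M} (f : M →ₗ[ℝ] ℝ) (hf : ∀ x ∈ X, f x = 0 → x = 0) {k : ℕ}
    (hk : Module.rank ℝ X = k) : k ≤ 1 := by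
  have hinj : Function.Injective (f.comp X.subtype) := by
    rw [← LinearMap.ker_eq_bot, LinearMap.ker_eq_bot']
    exact fun x hx => Subtype.ext (hf x x.2 hx)
  have := LinearMap.lift_rank_le_of_injective _ hinj
  rw [hk, Module.rank_self] at this
  simpa using this

variable {V E : Type*} {G : CompactMetricGraph V E}

lemma integrable_powInt {p : ℝ} (hp : 0 ≤ p) {ρ : ∀ e, G.Edge e → ℝ} (hρ : ∀ e, Integrable (ρ e))
    (f : ∀ e, C(G.Edge e, ℝ)) (e : E) : Integrable fun x => ρ e x * |f e x| ^ p :=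
  integrable_weight_mul (hρ e)
    ⟨fun x => |f e x| ^ p, (f e).continuous.abs.rpow_const fun _ => Or.inr hp⟩

variable [Fintype E]

/-- The functional `∫ ρ |f|^p`. -/
def powInt (p : ℝ) (ρ : ∀ e, G.Edge e → ℝ) (f : ∀ e, C(G.Edge e, ℝ)) : ℝ :=
  integral fun e x => ρ e x * |f e x| ^ p

lemma continuous_powInt {p : ℝ} (hp : 0 ≤ p) {ρ : ∀ e, G.Edge e → ℝ}
    (hρ : ∀ e, Integrable (ρ e)) : Continuous (powInt (G := G) p ρ) := by
  let T : C(ℝ, ℝ) := ⟨fun y => |y| ^ p, continuous_abs.rpow_const fun _ => Or.inr hp⟩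
  exact continuous_finsetSum _ fun e _ => (continuous_integral_weight (hρ e)).comp
    ((ContinuousMap.continuous_postcomp T).comp (continuous_apply e))

lemma powInt_nonneg {p : ℝ} {ρ : ∀ e, G.Edge e → ℝ} (hρ0 : ∀ e, ∀ᵐ x, 0 ≤ ρ e x)
    (f : ∀ e, C(G.Edge e, ℝ)) : 0 ≤ powInt p ρ f := by
  refine integral_nonneg fun e => ?_
  filter_upwards [hρ0 e] with x hx
  exact mul_nonneg hx (Real.rpow_nonneg (abs_nonneg _) _)

lemma powInt_smul (p : ℝ) (ρ : ∀ e, G.Edge e → ℝ) (s : ℝ) (f : ∀ e, C(G.Edge e, ℝ)) :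
    powInt p ρ (s • f) = |s| ^ p * powInt p ρ f := by
  rw [powInt, powInt, ← integral_const_mul]
  congr! 3 with e x
  rw [Pi.smul_apply, ContinuousMap.smul_apply, smul_eq_mul, abs_mul,
    Real.mul_rpow (abs_nonneg _) (abs_nonneg _)]
  ring

lemma exists_val_bound (u : G.H1) : ∃ M, 0 ≤ M ∧ ∀ e x, |H1.val u e x| ≤ M :=
  ⟨∑ e, ‖u.1.1 e‖, by positivity, fun e x => ((u.1.1 e).norm_coe_le_norm x).trans
    (Finset.single_le_sum (f := fun e => ‖u.1.1 e‖) (fun _ _ => norm_nonneg _)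
      (Finset.mem_univ e))⟩

lemma integral_combination {f₀ f₁ f₂ f₃ : ∀ e, G.Edge e → ℝ} (h₀ : ∀ e, Integrable (f₀ e))
    (h₁ : ∀ e, Integrable (f₁ e)) (h₂ : ∀ e, Integrable (f₂ e)) (h₃ : ∀ e, Integrable (f₃ e))
    (a b c : ℝ) : integral (fun e x => (f₀ e x + a * f₁ e x) + (b * f₂ e x - c * f₃ e x))
      = (integral f₀ + a * integral f₁) + (b * integral f₂ - c * integral f₃) := by
  rw [integral_add (f := fun e x => f₀ e x + a * f₁ e x) (g := fun e x => b * f₂ e x - c * f₃ e x)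
      (fun e => (h₀ e).add ((h₁ e).const_mul a))
      (fun e => ((h₂ e).const_mul b).sub ((h₃ e).const_mul c)),
    integral_add h₀ (fun e => (h₁ e).const_mul a),
    integral_sub (fun e => (h₂ e).const_mul b) (fun e => (h₃ e).const_mul c),
    integral_const_mul, integral_const_mul, integral_const_mul]

/-- A lower second order expansion of `t ↦ ∫ ρ |u + t φ|^p`. -/
lemma exists_powInt_lower_expansion {p : ℝ} (hp : 2 < p) {ρ : ∀ e, G.Edge e → ℝ}
    (hρ : ∀ e, Integrable (ρ e)) (hρ0 : ∀ e, ∀ᵐ x, 0 ≤ ρ e x) (u φ : G.H1) {ε : ℝ} (hε : 0 < ε) :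
    ∃ δ > 0, ∀ t : ℝ, |t| ≤ δ →
      powInt p ρ u.1.1 + t * (p * mass (nlWeight p ρ u) (integrable_nlWeight hp hρ u) u φ)
        + t ^ 2 * ((p * (p - 1) * mass (nlWeight p ρ u) (integrable_nlWeight hp hρ u) φ φ - ε) / 2)
        ≤ powInt p ρ (u + t • φ).1.1 := by
  obtain ⟨M, -, hM⟩ := exists_val_bound u
  obtain ⟨M', hM'0, hM'⟩ := exists_val_bound φ
  set R := mass ρ hρ φ φ with hR
  have hR0 : 0 ≤ R := mass_self_nonneg hρ hρ0 φ
  -- The pointwise error is integrated against ρφ², of total mass R; hence the tolerance ε/(R+1).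
  obtain ⟨δ, hδ, H⟩ := exists_abs_rpow_lower_expansion hp M (ε := ε / (R + 1)) (by positivity)
  refine ⟨δ / (M' + 1), by positivity, fun t ht => ?_⟩
  rw [le_div_iff₀ (by positivity)] at ht
  have hnl := integrable_nlWeight hp hρ u
  have i0 := integrable_powInt (by linarith : 0 ≤ p) hρ u.1.1
  have i1 := integrable_mass hnl u φ
  have i2 := integrable_mass hnl φ φ
  have i3 := integrable_mass hρ φ φ
  have hmain : integral (fun e x => (ρ e x * |u.1.1 e x| ^ p
      + t * p * (nlWeight p ρ u e x * H1.val u e x * H1.val φ e x))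
      + (t ^ 2 / 2 * (p * (p - 1)) * (nlWeight p ρ u e x * H1.val φ e x * H1.val φ e x)
      - t ^ 2 / 2 * (ε / (R + 1)) * (ρ e x * H1.val φ e x * H1.val φ e x)))
      ≤ powInt p ρ (u + t • φ).1.1 := by
    refine integral_mono (fun e => ((i0 e).add ((i1 e).const_mul _)).add
      (((i2 e).const_mul _).sub ((i3 e).const_mul _)))
      (integrable_powInt (by linarith : 0 ≤ p) hρ _) fun e => ?_
    filter_upwards [hρ0 e] with x hx
    have h1 := H (H1.val u e x) (t * H1.val φ e x) (hM e x) (by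
      rw [abs_mul]
      have := mul_le_mul_of_nonneg_left (hM' e x) (abs_nonneg t)
      linarith [abs_nonneg t])
    have h2 := mul_le_mul_of_nonneg_left h1 hx
    have h3 : (u + t • φ).1.1 e x = H1.val u e x + t * H1.val φ e x := rfl
    rw [h3]
    refine le_trans (le_of_eq ?_) h2
    simp only [nlWeight, H1.val]
    ring
  have hcomb := integral_combination i0 i1 i2 i3 (t * p) (t ^ 2 / 2 * (p * (p - 1)))
    (t ^ 2 / 2 * (ε / (R + 1)))
  refine le_trans (le_trans ?_ hcomb.ge) hmain
  rw [← mass_apply hnl u φ, ← mass_apply hnl φ φ, ← mass_apply hρ φ φ, ← hR]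
  have h4 : t ^ 2 / 2 * (ε / (R + 1)) * R ≤ t ^ 2 / 2 * ε := by
    have h6 : ε / (R + 1) * R ≤ ε := by
      rw [div_mul_eq_mul_div, div_le_iff₀ (by positivity)]
      nlinarith
    rw [mul_assoc]
    exact mul_le_mul_of_nonneg_left h6 (by positivity)
  have h5 : powInt p ρ u.1.1 = integral fun e x => ρ e x * |u.1.1 e x| ^ p := rfl
  rw [h5]
  linarith

lemma mass_nlWeight_smul {p : ℝ} (hp : 2 < p) {ρ : ∀ e, G.Edge e → ℝ}
    (hρ : ∀ e, Integrable (ρ e)) {s : ℝ} (hs : 0 ≤ s) (u v w : G.H1) :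
    mass (nlWeight p ρ (s • u)) (integrable_nlWeight hp hρ (s • u)) v w
      = s ^ (p - 2) * mass (nlWeight p ρ u) (integrable_nlWeight hp hρ u) v w := by
  rw [mass_apply, mass_apply, ← integral_const_mul]
  congr! 3 with e x
  rw [nlWeight, nlWeight, val_smul, abs_mul, abs_of_nonneg hs, Real.mul_rpow hs (abs_nonneg _)]
  ring

/-- First and second order conditions at a minimum of `A(w) / (∫ ρ |w|^p)^(2/p)`. -/
lemma minimizer_conditions {p : ℝ} (hp : 2 < p) {ρ : ∀ e, G.Edge e → ℝ}
    (hρ : ∀ e, Integrable (ρ e)) (hρ0 : ∀ e, ∀ᵐ x, 0 ≤ ρ e x) {A : LinearMap.BilinForm ℝ G.H1}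
    (hA : ∀ u v, A u v = A v u) {u : G.H1} (hS : 0 ≤ A u u) (hu : powInt p ρ u.1.1 = 1)
    (hmin : ∀ w : G.H1, A u u * powInt p ρ w.1.1 ^ (2 / p) ≤ A w w) (φ : G.H1) :
    A u φ = A u u * mass (nlWeight p ρ u) (integrable_nlWeight hp hρ u) u φ ∧
      (mass (nlWeight p ρ u) (integrable_nlWeight hp hρ u) u φ = 0 →
        (p - 1) * (A u u * mass (nlWeight p ρ u) (integrable_nlWeight hp hρ u) φ φ) ≤ A φ φ) := by
  set S := A u u with hSdef
  set B := mass (nlWeight p ρ u) (integrable_nlWeight hp hρ u) u φ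
  set C := mass (nlWeight p ρ u) (integrable_nlWeight hp hρ u) φ φ
  have hp0 : 0 < p := by linarith
  have hexp : ∀ t : ℝ, A (u + t • φ) (u + t • φ) = S + t * (2 * A u φ) + t ^ 2 * A φ φ := fun t => by
    simp only [map_add, map_smul, LinearMap.add_apply, LinearMap.smul_apply, smul_eq_mul, hA φ u]
    ring
  -- Since S ≥ 0, minimality needs only a lower bound on the power integral, so the one-sided
  -- expansion suffices.
  have key : ∀ ε > 0, ∀ᶠ t in 𝓝 (0 : ℝ), S * (1 + t * (p * B)
      + t ^ 2 * ((p * (p - 1) * C - ε) / 2)) ^ (2 / p) ≤ S + t * (2 * A u φ) + t ^ 2 * A φ φ := by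
    intro ε hε
    obtain ⟨δ, hδ, H⟩ := exists_powInt_lower_expansion hp hρ hρ0 u φ hε
    have hc : ContinuousAt (fun t : ℝ => 1 + t * (p * B)
      + t ^ 2 * ((p * (p - 1) * C - ε) / 2)) 0 := by fun_prop
    have h1 := hc.eventually_const_lt (u := 0) (by norm_num)
    filter_upwards [h1, Metric.ball_mem_nhds (0 : ℝ) hδ] with t ht htδ
    rw [Metric.mem_ball, dist_zero_right] at htδ
    have h2 := H t htδ.le
    rw [hu] at h2
    rw [← hexp]
    refine le_trans ?_ (hmin (u + t • φ))
    exact mul_le_mul_of_nonneg_left (Real.rpow_le_rpow ht.le h2 (by positivity)) hS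
  have hder : ∀ b κ : ℝ, HasDerivAt (fun t : ℝ => (1 + t * b + t ^ 2 * κ) ^ (2 / p))
      (b * (2 / p)) 0 := by
    intro b κ
    have h1 : HasDerivAt (fun t : ℝ => 1 + t * b + t ^ 2 * κ) b 0 := by
      have := (((hasDerivAt_id (0 : ℝ)).mul_const b).const_add 1).add
        (((hasDerivAt_id (0 : ℝ)).pow 2).mul_const κ)
      exact this.congr_deriv (by simp)
    simpa using h1.rpow_const (p := 2 / p) (Or.inl (by norm_num))
  have hpol : ∀ b κ : ℝ, HasDerivAt (fun t : ℝ => S + t * b + t ^ 2 * κ) b 0 := by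
    intro b κ
    have := (((hasDerivAt_id (0 : ℝ)).mul_const b).const_add S).add
      (((hasDerivAt_id (0 : ℝ)).pow 2).mul_const κ)
    exact this.congr_deriv (by simp)
  have hfirst : A u φ = S * B := by
    have hd := (hpol (2 * A u φ) (A φ φ)).sub
      ((hder (p * B) ((p * (p - 1) * C - 1) / 2)).const_mul S)
    -- Right minus left side of `key` is nonnegative near 0 and vanishes at 0, so its derivative
    -- 2A(u,φ) − 2SB is zero. The tolerance 1 is arbitrary, as it affects only the t² term.
    have hloc : IsLocalMin ((fun t : ℝ => S + t * (2 * A u φ) + t ^ 2 * A φ φ)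
        - fun t => S * (1 + t * (p * B) + t ^ 2 * ((p * (p - 1) * C - 1) / 2)) ^ (2 / p)) 0 := by
      filter_upwards [key 1 one_pos] with t ht
      simp only [Pi.sub_apply]
      norm_num
      exact ht
    have h0 := hloc.hasDerivAt_eq_zero hd
    have h1 : p * B * (2 / p) = 2 * B := by field_simp
    rw [h1] at h0
    linarith
  refine ⟨hfirst, fun hB => ?_⟩
  rw [hB, mul_zero] at hfirst
  refine le_of_forall_pos_le_add fun η hη => ?_
  -- Makes the final loss Sε/p at most η.
  set ε := η * p / (S + 1) with hε
  have hε0 : 0 < ε := by positivity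
  set κ := (p * (p - 1) * C - ε) / 2 with hκ
  have hk := key ε hε0
  rw [hB, hfirst] at hk
  have hd := (hpol (A φ φ) 0).sub ((hder κ 0).const_mul S)
  have hlim := hd.tendsto_slope.mono_left (nhdsGT_le_nhdsNE (0 : ℝ))
  -- Without first order terms the inequality involves only t². Putting t = √s turns the second
  -- order condition into a one-sided derivative at s = 0.
  have hev : ∀ᶠ s in 𝓝[>] (0 : ℝ), (0 : ℝ) ≤ slope ((fun t : ℝ => S + t * A φ φ + t ^ 2 * 0)
      - fun t => S * (1 + t * κ + t ^ 2 * 0) ^ (2 / p)) (0 : ℝ) s := by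
    have hsq : Tendsto Real.sqrt (𝓝[>] (0 : ℝ)) (𝓝 0) := by
      have := Real.continuous_sqrt.tendsto 0
      rw [Real.sqrt_zero] at this
      exact this.mono_left nhdsWithin_le_nhds
    filter_upwards [hsq.eventually hk, self_mem_nhdsWithin] with s hs hs0
    have hs0' : 0 < s := hs0
    rw [Real.sq_sqrt hs0'.le] at hs
    rw [slope_def_field]
    refine div_nonneg ?_ (by simpa using hs0'.le)
    simp only [Pi.sub_apply, mul_zero, add_zero, zero_mul, Real.one_rpow, mul_one] at hs ⊢
    linarith
  have h1 := ge_of_tendsto hlim hev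
  have h2 : S * (κ * (2 / p)) = (p - 1) * (S * C) - S * (ε / p) := by
    rw [hκ]; field_simp
  have h3 : S * (ε / p) ≤ η := by
    rw [hε, show S * (η * p / (S + 1) / p) = η * (S / (S + 1)) by field_simp]
    have : S / (S + 1) ≤ 1 := by rw [div_le_one (by positivity)]; linarith
    exact mul_le_of_le_one_right hη.le this
  rw [h2] at h1
  linarith

/-- Above `-λ_1` there is a nonzero solution of Morse index at most one. -/
theorem exists_ground_state [Nonempty E] {p : ℝ} (hp : 2 < p)
    {W ρ : ∀ e, G.Edge e → ℝ} (hW : ∀ e, MemLp (W e) ⊤ volume) (hρ : ∀ e, Integrable (ρ e))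
    {b : ℝ} (hb : 0 < b) (hρb : ∀ e, ∀ᵐ x, b ≤ ρ e x) {lam : ℝ} (h : -eigenvalue W 1 < lam) :
    ∃ u : G.H1, u ≠ 0 ∧ IsSolution p W ρ lam u ∧ morseIndex p W ρ lam u ≤ 1 := by
  have hWi : ∀ e, Integrable (W e) := fun e => (hW e).integrable le_top
  have hρ0 : ∀ e, ∀ᵐ x, 0 ≤ ρ e x := fun e => (hρb e).mono fun x hx => hb.le.trans hx
  have hp0 : 0 < p := by linarith
  obtain ⟨M, -, hM⟩ := exists_weight_bound hW
  have hco := coercive_of_gap hWi hM (first_eigenvalue hW hWi).1 h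
  -- Serves only as a competitor with ∫ ρ|φ|^p > 0.
  obtain ⟨φ, hφ, -⟩ := exists_pos_eigenfunction hW hWi
  have hφpow : 0 < powInt p ρ φ.1.1 := by
    obtain ⟨e₀⟩ := ‹Nonempty E›
    exact integral_pos_of_weight hρ hb hρb (fun e => ⟨fun x => |H1.val φ e x| ^ p,
      (continuous_val φ e).abs.rpow_const fun _ => Or.inr hp0.le⟩)
      (fun e x => Real.rpow_nonneg (abs_nonneg _) _) (e₀ := e₀) (x₀ := G.left e₀)
      (Real.rpow_pos_of_pos (abs_pos.2 (hφ _ _).ne') _).ne'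
  obtain ⟨u, -, hu1, hmin⟩ := exists_minimizer hco (fun f => powInt p ρ f ^ (2 / p))
    ((continuous_powInt hp0.le hρ).rpow_const fun _ => Or.inr (by positivity))
    (fun s f => by
      rw [powInt_smul, Real.mul_rpow (by positivity) (powInt_nonneg hρ0 f),
        ← Real.rpow_mul (abs_nonneg s), mul_div_cancel₀ _ hp0.ne', Real.rpow_two, sq_abs])
    ⊤ isClosed_univ ⟨φ, trivial, Real.rpow_pos_of_pos hφpow _⟩
  set A := energy (fun e x => W e x + lam) (integrable_weight_add_const hWi lam) with hAdef
  have hA : ∀ v w, A v w = energy W hWi v w + lam * l2 v w := energy_add_const hWi lam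
  have hupow : powInt p ρ u.1.1 = 1 := by
    have h1 : (powInt p ρ u.1.1 ^ (2 / p)) ^ (p / 2) = 1 := by rw [hu1, Real.one_rpow]
    rwa [← Real.rpow_mul (powInt_nonneg hρ0 _), div_mul_div_cancel₀ hp0.ne',
      div_self two_ne_zero, Real.rpow_one] at h1
  have hu0 : u ≠ 0 := by
    rintro rfl
    have : powInt p ρ (0 : G.H1).1.1 = 0 := by
      have := powInt_smul p ρ 0 (0 : G.H1).1.1
      rwa [zero_smul, abs_zero, Real.zero_rpow hp0.ne', zero_mul] at this
    rw [this] at hupow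
    exact zero_ne_one hupow
  have hS : 0 < A u u := by
    obtain ⟨α, hα, hco⟩ := hco
    exact (mul_pos hα (add_pos_of_nonneg_of_pos (dirichlet_self_nonneg u) (l2_self_pos hu0))).trans_le
      (hco u)
  have hcond := minimizer_conditions hp hρ hρ0 (energy_comm _) hS.le hupow
    (fun w => hmin w trivial)
  -- Scaling u by s multiplies the weight |u|^(p−2) by s^(p−2) = A(u,u), the Lagrange multiplier.
  set s := A u u ^ (p - 2)⁻¹ with hs
  have hs0 : 0 < s := Real.rpow_pos_of_pos hS _
  have hsp : s ^ (p - 2) = A u u := by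
    rw [hs, ← Real.rpow_mul hS.le, inv_mul_cancel₀ (by linarith), Real.rpow_one]
  refine ⟨s • u, smul_ne_zero hs0.ne' hu0, ?_, ?_⟩
  · rw [isSolution_iff hp hWi hρ]
    intro ψ
    rw [← hA, mass_nlWeight_smul hp hρ hs0.le, hsp, map_smul, map_smul, LinearMap.smul_apply,
      LinearMap.smul_apply, (hcond ψ).1, smul_eq_mul, smul_eq_mul]
    ring
  · refine sSup_le ?_
    rintro _ ⟨k, X, rfl, hk, hX⟩
    -- On the kernel of φ ↦ ∫ ρ|u|^(p−2)uφ the second order condition excludes negative values of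
    -- the form.
    have hle := Submodule.rank_le_one_of_ker
      (mass (nlWeight p ρ u) (integrable_nlWeight hp hρ u) u) (fun x hx hx0 => by
        by_contra hne
        have h1 := hX x hx hne
        rw [quadForm_eq hp hWi hρ, ← hA, mass_nlWeight_smul hp hρ hs0.le, hsp] at h1
        linarith [(hcond x).2 hx0]) hk
    exact_mod_cast hle

end CompactMetricGraph

end

/-! ### Conclusion -/

theorem mainTheorem6 {V E : Type*} [Fintype E] (G : CompactMetricGraph V E)
    (p : ℝ) (hp : 2 < p) (m : ℕ) (hm : 0 < m)
    (W ρ : ∀ e, G.Edge e → ℝ)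
    (hW : ∀ e, MeasureTheory.MemLp (W e) ⊤ MeasureTheory.volume)
    (hρ : ∀ e, MeasureTheory.MemLp (ρ e) ⊤ MeasureTheory.volume)
    (hρ_ne : ¬ ∀ e, ∀ᵐ x, ρ e x = 0)
    (hρ_edge : ∃ a > 0, ∀ e, (∀ᵐ x, a ≤ ρ e x) ∨ (∀ᵐ x, ρ e x = 0)) :
    ((-CompactMetricGraph.eigenvalue W (m + 1) : ℝ) : EReal)
        ≤ CompactMetricGraph.bottom p W ρ m ∧
      (m = 1 → (∃ c > 0, ∀ e, ∀ᵐ x, c ≤ ρ e x) →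
        CompactMetricGraph.bottom p W ρ m
            = ((-CompactMetricGraph.eigenvalue W 1 : ℝ) : EReal) ∧
          ∀ lam ∈ CompactMetricGraph.admissible p W ρ m,
            (lam : EReal) ≠ CompactMetricGraph.bottom p W ρ m) := by
  -- On a graph without edges ρ would vanish vacuously.
  have hne : Nonempty E := by
    by_contra h
    rw [not_nonempty_iff] at h
    exact hρ_ne fun e => h.elim e
  have hρi : ∀ e, MeasureTheory.Integrable (ρ e) := fun e => (hρ e).integrable le_top
  have hρ0 : ∀ e, ∀ᵐ x, 0 ≤ ρ e x := by
    obtain ⟨a, ha, h⟩ := hρ_edge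
    intro e
    rcases h e with h | h
    · exact h.mono fun x hx => ha.le.trans hx
    · exact h.mono fun x hx => hx.ge
  refine ⟨le_iInf₂ fun lam hlam => EReal.coe_le_coe_iff.2 ?_, ?_⟩
  · obtain ⟨u, -, -, hu⟩ := hlam
    by_contra! hlt
    have h := (CompactMetricGraph.le_morseIndex_of_lt_neg_eigenvalue hp hW hρi hρ0 hlt u).trans hu
    have : m + 1 ≤ m := by exact_mod_cast h
    omega
  · rintro rfl ⟨c, hc, hρc⟩
    have hgt : ∀ lam ∈ CompactMetricGraph.admissible p W ρ 1,
        -CompactMetricGraph.eigenvalue W 1 < lam := by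
      rintro lam ⟨u, hu0, hsol, hu⟩
      by_contra! hle
      have h := (CompactMetricGraph.two_le_morseIndex_of_le_neg_eigenvalue hp hW hρi hc hρc hle
        hu0 hsol).trans hu
      exact absurd h (by norm_num)
    have hbot : CompactMetricGraph.bottom p W ρ 1
        = ((-CompactMetricGraph.eigenvalue W 1 : ℝ) : EReal) := by
      -- Every real t above −λ_1 is admissible, so the infimum cannot exceed −λ_1.
      refine le_antisymm (EReal.le_of_forall_lt_iff_le.1 fun t ht => ?_)
        (le_iInf₂ fun lam hlam => EReal.coe_le_coe_iff.2 (hgt lam hlam).le)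
      obtain ⟨u, hu0, hsol, hu⟩ := CompactMetricGraph.exists_ground_state hp hW hρi hc hρc
        (EReal.coe_lt_coe_iff.1 ht)
      exact iInf₂_le t ⟨u, hu0, hsol, by exact_mod_cast hu⟩
    refine ⟨hbot, fun lam hlam h => ?_⟩
    rw [hbot, EReal.coe_eq_coe_iff] at h
    exact (hgt lam hlam).ne' h
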